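/- **Setting.** Let $E$ be a complex Banach lattice, that is, the complexification $E=E_{\mathbb R}+iE_{\mathbb R}$ of a real Banach lattice $E_{\mathbb R}$, with modulus $|x+iy|=\sqrt{x^2+y^2}=\sup\{x\cos\varphi+y\sin\varphi:0\le\varphi\le2\pi\}$ and norm $\|z\|=\|\,|z|\,\|$. For $z,w\in E$ and $0<\theta<1$ the element $|z|^\theta|w|^{1-\theta}\in E_{\mathbb R}$ is defined by the Krivine functional calculus. An $m$-homogeneous polynomial $P(x)=A(x,\dots,x)$, with $A$ symmetric and $m$-linear, from $E_{\mathbb R}$ to $\mathbb R$ is *positive* if $A(x_1,\dots,x_m)\ge0$ for all $x_1,\dots,x_m\ge0$, and *regular* if it is a difference of two positive $m$-homogeneous polynomials; $P\le Q$ means that $Q-P$ is positive. An $m$-homogeneous polynomial $P\colon E\to\mathbb C$ is *regular* if its real and imaginary parts $P_0,P_1$, the real polynomials on $E_{\mathbb R}$ with $P(x)=P_0(x)+iP_1(x)$ for $x\in E_{\mathbb R}$, are regular; its absolute value is the supremum $|P|=\sup_{0\le\varphi\le2\pi}(P_0\cos\varphi+P_1\sin\varphi)$ in the lattice of regular real $m$-homogeneous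 polynomials on $E_{\mathbb R}$. **Theorem.** Let $\sum_{m\ge0}P_m$ be a power series on $E$ in which every $P_m\colon E\to\mathbb C$ is a regular $m$-homogeneous polynomial, and let $D$ be the set of all $z\in E$ at which it converges regularly, i.e. $\sum_m|P_m|(|z|)<\infty$. Then 1. $D$ is solid: if $z\in D$, $w\in E$ and $|w|\le|z|$, then $w\in D$; 2. $D$ is logarithmically convex: if $z,w\in D$ and $0<\theta<1$, then $|z|^\theta|w|^{1-\theta}\in D$. Moreover, for every $m\ge0$, every positive $m$-homogeneous polynomial $P\colon E_{\mathbb R}\to\mathbb R$, all $z,w\in E$ and $0<\theta<1$, $$P\bigl(|z|^\theta|w|^{1-\theta}\bigr)\le P(|z|)^\theta\,P(|w|)^{1-\theta}.$$ -/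

import Mathlib

namespace ComplexBanachLattice

open scoped Pointwise

noncomputable section

set_option linter.unusedSectionVars false

section Krivine

variable {n : ℕ} {E : Type*} [NormedAddCommGroup E] [Lattice E] [IsOrderedAddMonoid E]
  [NormedSpace ℝ E] [IsOrderedModule ℝ E]

/-- The maximum of the finitely many linear forms with coefficient vectors in `a`. -/
def maxLin (a : Finset (Fin n → ℝ)) (ha : a.Nonempty) (x : Fin n → E) : E :=
  a.sup' ha fun α => ∑ i, α i • x i

theorem maxLin_mono {a b : Finset (Fin n → ℝ)} (ha : a.Nonempty) (hb : b.Nonempty)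
    (h : ∀ t : Fin n → ℝ, maxLin a ha t ≤ maxLin b hb t) (x : Fin n → E) :
    maxLin a ha x ≤ maxLin b hb x := by
  refine Finset.sup'_le _ _ fun α hα => ?_
  have hmem : α ∈ convexHull ℝ (b : Set (Fin n → ℝ)) := by
    by_contra hc
    obtain ⟨f, u, hf1, hf2⟩ := geometric_hahn_banach_closed_point
      (convex_convexHull ℝ (b : Set (Fin n → ℝ)))
      (b.finite_toSet.isClosed_convexHull ℝ) hc
    have hrep : ∀ β : Fin n → ℝ, f β = ∑ i, β i • f (Pi.single i 1) := by
      intro β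
      conv_lhs => rw [pi_eq_sum_univ' β]
      simp [map_sum]
    have h1 := h fun i => f (Pi.single i 1)
    have h2 : f α ≤ maxLin a ha fun i => f (Pi.single i 1) := by
      rw [hrep]
      exact Finset.le_sup' (fun α : Fin n → ℝ => ∑ i, α i • f (Pi.single i 1)) hα
    have h3 : maxLin b hb (fun i => f (Pi.single i 1)) ≤ u := by
      refine Finset.sup'_le _ _ fun β hβ => ?_
      rw [← hrep]
      exact (hf1 β (subset_convexHull ℝ _ hβ)).le
    linarith
  rw [Finset.mem_convexHull'] at hmem
  obtain ⟨w, hw0, hw1, hw2⟩ := hmem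
  have : ∑ i, α i • x i = ∑ β ∈ b, w β • ∑ i, β i • x i := by
    rw [← hw2]
    simp only [Finset.smul_sum, Finset.sum_apply, Finset.sum_smul, Pi.smul_apply, smul_eq_mul,
      mul_smul]
    rw [Finset.sum_comm]
  rw [this]
  calc ∑ β ∈ b, w β • ∑ i, β i • x i ≤ ∑ β ∈ b, w β • maxLin b hb x :=
        Finset.sum_le_sum fun β hβ => smul_le_smul_of_nonneg_left
          (Finset.le_sup' (fun α : Fin n → ℝ => ∑ i, α i • x i) hβ) (hw0 β hβ)
    _ = maxLin b hb x := by rw [← Finset.sum_smul, hw1, one_smul]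

theorem maxLin_add {a b : Finset (Fin n → ℝ)} (ha : a.Nonempty) (hb : b.Nonempty)
    (x : Fin n → E) : maxLin (a + b) (ha.add hb) x = maxLin a ha x + maxLin b hb x := by
  apply le_antisymm
  · refine Finset.sup'_le _ _ fun γ hγ => ?_
    obtain ⟨α, hα, β, hβ, rfl⟩ := Finset.mem_add.1 hγ
    simp only [Pi.add_apply, add_smul, Finset.sum_add_distrib]
    exact add_le_add (Finset.le_sup' (fun α : Fin n → ℝ => ∑ i, α i • x i) hα)
      (Finset.le_sup' (fun α : Fin n → ℝ => ∑ i, α i • x i) hβ)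
  · rw [← le_sub_iff_add_le]
    refine Finset.sup'_le _ _ fun α hα => ?_
    rw [le_sub_comm]
    refine Finset.sup'_le _ _ fun β hβ => ?_
    rw [le_sub_iff_add_le']
    have := Finset.le_sup' (fun α : Fin n → ℝ => ∑ i, α i • x i) (Finset.add_mem_add hα hβ)
    simp only [Pi.add_apply, add_smul, Finset.sum_add_distrib] at this
    exact this

theorem maxLin_smul {a : Finset (Fin n → ℝ)} (ha : a.Nonempty) {c : ℝ} (hc : 0 < c)
    (x : Fin n → E) : maxLin (c • a) (ha.smul_finset (a := c)) x = c • maxLin a ha x := by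
  apply le_antisymm
  · refine Finset.sup'_le _ _ fun γ hγ => ?_
    obtain ⟨α, hα, rfl⟩ := Finset.mem_smul_finset.1 hγ
    simp only [Pi.smul_apply, smul_eq_mul, mul_smul, ← Finset.smul_sum]
    exact smul_le_smul_of_nonneg_left
      (Finset.le_sup' (fun α : Fin n → ℝ => ∑ i, α i • x i) hα) hc.le
  · have h : maxLin a ha x ≤ c⁻¹ • maxLin (c • a) (ha.smul_finset (a := c)) x := by
      refine Finset.sup'_le _ _ fun α hα => ?_
      have := Finset.le_sup' (fun α : Fin n → ℝ => ∑ i, α i • x i)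
        (Finset.smul_mem_smul_finset (a := c) hα)
      have h2 := smul_le_smul_of_nonneg_left this (inv_pos.2 hc).le
      simp only [Pi.smul_apply, smul_eq_mul, mul_smul, ← Finset.smul_sum] at h2
      rwa [smul_smul, inv_mul_cancel₀ hc.ne', one_smul] at h2
    have := smul_le_smul_of_nonneg_left h hc.le
    rwa [smul_smul, mul_inv_cancel₀ hc.ne', one_smul] at this

theorem maxLin_union {a b : Finset (Fin n → ℝ)} (ha : a.Nonempty) (hb : b.Nonempty)
    (x : Fin n → E) :
    maxLin (a ∪ b) (ha.mono Finset.subset_union_left) x = maxLin a ha x ⊔ maxLin b hb x :=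
  Finset.sup'_union ha hb _

/-- `v` is the value at `x` of the piecewise linear function `f`, written as a difference of two
maxima of linear forms. -/
def PLValue (x : Fin n → E) (f : (Fin n → ℝ) → ℝ) (v : E) : Prop :=
  ∃ a, ∃ ha : a.Nonempty, ∃ b, ∃ hb : b.Nonempty,
    (∀ t : Fin n → ℝ, f t = maxLin a ha t - maxLin b hb t) ∧ v = maxLin a ha x - maxLin b hb x

variable {x : Fin n → E} {f g : (Fin n → ℝ) → ℝ} {v w : E}

theorem PLValue.mono (hf : PLValue x f v) (hg : PLValue x g w) (h : ∀ t, f t ≤ g t) : v ≤ w := by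
  obtain ⟨a, ha, b, hb, hf, rfl⟩ := hf
  obtain ⟨c, hc, d, hd, hg, rfl⟩ := hg
  rw [sub_le_sub_iff, ← maxLin_add ha hd, ← maxLin_add hc hb]
  refine maxLin_mono _ _ (fun t => ?_) x
  rw [maxLin_add ha hd, maxLin_add hc hb]
  have := h t
  rw [hf, hg] at this
  linarith

theorem PLValue.add (hf : PLValue x f v) (hg : PLValue x g w) :
    PLValue x (fun t => f t + g t) (v + w) := by
  obtain ⟨a, ha, b, hb, hf, rfl⟩ := hf
  obtain ⟨c, hc, d, hd, hg, rfl⟩ := hg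
  refine ⟨a + c, ha.add hc, b + d, hb.add hd, fun t => ?_, ?_⟩
  · simp only [hf, hg, maxLin_add ha hc, maxLin_add hb hd]; ring
  · rw [maxLin_add ha hc, maxLin_add hb hd]; abel

theorem PLValue.neg (hf : PLValue x f v) : PLValue x (fun t => - f t) (-v) := by
  obtain ⟨a, ha, b, hb, hf, rfl⟩ := hf
  exact ⟨b, hb, a, ha, fun t => by simp only [hf]; ring, by abel⟩

theorem PLValue.linear (x : Fin n → E) (α : Fin n → ℝ) :
    PLValue x (fun t => ∑ i, α i * t i) (∑ i, α i • x i) := by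
  refine ⟨{α}, by simp, {0}, by simp, fun t => ?_, ?_⟩ <;> simp [maxLin]

theorem PLValue.pos_smul (hf : PLValue x f v) {c : ℝ} (hc : 0 < c) :
    PLValue x (fun t => c * f t) (c • v) := by
  obtain ⟨a, ha, b, hb, hf, rfl⟩ := hf
  refine ⟨c • a, ha.smul_finset, c • b, hb.smul_finset, fun t => ?_, ?_⟩
  · simp only [hf, maxLin_smul ha hc, maxLin_smul hb hc, smul_eq_mul, mul_sub]
  · rw [maxLin_smul ha hc, maxLin_smul hb hc, smul_sub]

theorem PLValue.smul (hf : PLValue x f v) (c : ℝ) : PLValue x (fun t => c * f t) (c • v) := by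
  rcases lt_trichotomy c 0 with h | rfl | h
  · simpa using (hf.pos_smul (neg_pos.2 h)).neg
  · simpa using PLValue.linear x 0
  · exact hf.pos_smul h

theorem PLValue.sup (hf : PLValue x f v) (hg : PLValue x g w) :
    PLValue x (fun t => f t ⊔ g t) (v ⊔ w) := by
  obtain ⟨a, ha, b, hb, hf, rfl⟩ := hf
  obtain ⟨c, hc, d, hd, hg, rfl⟩ := hg
  refine ⟨(a + d) ∪ (c + b), (ha.add hd).mono Finset.subset_union_left, b + d, hb.add hd,
    fun t => ?_, ?_⟩
  · simp only [hf, hg, maxLin_union (ha.add hd) (hc.add hb), maxLin_add ha hd, maxLin_add hc hb,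
      maxLin_add hb hd, ← max_sub_sub_right]
    congr 1 <;> ring
  · rw [maxLin_union (ha.add hd) (hc.add hb), maxLin_add ha hd, maxLin_add hc hb,
      maxLin_add hb hd, sub_eq_add_neg (_ ⊔ _), sup_add]
    congr 1 <;> abel

theorem PLValue.homog (hf : PLValue x f v) {c : ℝ} (hc : 0 < c) (t : Fin n → ℝ) :
    f (c • t) = c * f t := by
  have key : ∀ (a : Finset (Fin n → ℝ)) (ha : a.Nonempty),
      maxLin a ha (c • t) = c * maxLin a ha t := by
    intro a ha
    rw [← smul_eq_mul, ← maxLin_smul ha hc]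
    unfold maxLin
    apply le_antisymm
    · refine Finset.sup'_le _ _ fun α hα => ?_
      refine le_trans (le_of_eq ?_) (Finset.le_sup' (fun α : Fin n → ℝ => ∑ i, α i • t i)
        (Finset.smul_mem_smul_finset (a := c) hα))
      exact Finset.sum_congr rfl fun i _ => by simp; ring
    · refine Finset.sup'_le _ _ fun γ hγ => ?_
      obtain ⟨α, hα, rfl⟩ := Finset.mem_smul_finset.1 hγ
      refine le_trans (le_of_eq ?_) (Finset.le_sup' (fun α : Fin n → ℝ => ∑ i, α i • (c • t) i) hα)
      exact Finset.sum_congr rfl fun i _ => by simp; ring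
  obtain ⟨a, ha, b, hb, hf, rfl⟩ := hf
  rw [hf, hf, key, key]; ring

theorem PLValue.continuous (hf : PLValue x f v) : Continuous f := by
  obtain ⟨a, ha, b, hb, hf, rfl⟩ := hf
  have key : ∀ (a : Finset (Fin n → ℝ)) (ha : a.Nonempty),
      Continuous fun t : Fin n → ℝ => maxLin a ha t := by
    intro a ha
    unfold maxLin
    exact Continuous.finset_sup'_apply ha fun α _ => by fun_prop
  rw [show f = fun t => maxLin a ha t - maxLin b hb t from funext hf]
  exact (key a ha).sub (key b hb)

/-- The coefficient vectors with entries `±1`; `maxLin signs` is `t ↦ ∑ i, |t i|`. -/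
def signs (n : ℕ) : Finset (Fin n → ℝ) := Fintype.piFinset fun _ => {1, -1}

theorem signs_nonempty (n : ℕ) : (signs n).Nonempty :=
  ⟨fun _ => 1, by simp [signs]⟩

theorem sum_abs_le_maxLin_signs (t : Fin n → ℝ) :
    ∑ i, |t i| ≤ maxLin (signs n) (signs_nonempty n) t := by
  have hmem : (fun i => if 0 ≤ t i then (1 : ℝ) else -1) ∈ signs n := by
    simp only [signs, Fintype.mem_piFinset]
    intro i
    split_ifs <;> simp
  refine le_trans (le_of_eq ?_) (Finset.le_sup' (fun α : Fin n → ℝ => ∑ i, α i • t i) hmem)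
  refine Finset.sum_congr rfl fun i _ => ?_
  split_ifs with h
  · simp [abs_of_nonneg h]
  · simp [abs_of_neg (not_le.1 h)]

theorem sqrt_le_maxLin_signs (t : Fin n → ℝ) :
    √(∑ i, t i ^ 2) ≤ maxLin (signs n) (signs_nonempty n) t := by
  refine le_trans ?_ (sum_abs_le_maxLin_signs t)
  rw [Real.sqrt_le_left (Finset.sum_nonneg fun i _ => abs_nonneg _)]
  simp only [← sq_abs (t _)]
  exact Finset.sum_sq_le_sq_sum_of_nonneg fun i _ => abs_nonneg _

theorem plValue_signs (x : Fin n → E) :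
    PLValue x (maxLin (signs n) (signs_nonempty n)) (maxLin (signs n) (signs_nonempty n) x) :=
  ⟨signs n, signs_nonempty n, {0}, by simp, fun t => by simp [maxLin], by simp [maxLin]⟩

theorem maxLin_signs_nonneg (x : Fin n → E) : 0 ≤ maxLin (signs n) (signs_nonempty n) x := by
  have h := PLValue.linear x 0
  simp only [Pi.zero_apply, zero_mul, zero_smul, Finset.sum_const_zero] at h
  exact h.mono (plValue_signs x) fun t => (Finset.sum_nonneg fun i _ => abs_nonneg _).trans
    (sum_abs_le_maxLin_signs t)

/-- The space of continuous functions on `ℝⁿ` that are positively homogeneous of degree one. -/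
def PosHom (n : ℕ) : Submodule ℝ C(Fin n → ℝ, ℝ) where
  carrier := {f | ∀ c : ℝ, 0 ≤ c → ∀ t, f (c • t) = c * f t}
  add_mem' hf hg c hc t := by simp [hf c hc t, hg c hc t, mul_add]
  zero_mem' c _ t := by simp
  smul_mem' r f hf c hc t := by simp [hf c hc t]; ring

theorem exists_plValue_approx (x : Fin n → E) (f : PosHom n) {ε : ℝ} (hε : 0 < ε) :
    ∃ g w, PLValue x g w ∧
      ∀ t, |f.1 t - g t| ≤ ε * maxLin (signs n) (signs_nonempty n) t := by
  let S : Set (Fin n → ℝ) := {t | ∑ i, t i ^ 2 = 1}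
  have hScl : IsClosed S := isClosed_eq (by fun_prop) continuous_const
  have hSbd : Bornology.IsBounded S := by
    refine (Metric.isBounded_closedBall (x := (0 : Fin n → ℝ)) (r := 1)).subset fun t ht => ?_
    rw [mem_closedBall_zero_iff, pi_norm_le_iff_of_nonneg zero_le_one]
    intro i
    rw [Real.norm_eq_abs, ← sq_le_one_iff_abs_le_one, ← (show ∑ i, t i ^ 2 = 1 from ht)]
    exact Finset.single_le_sum (f := fun i => t i ^ 2) (fun i _ => sq_nonneg _) (Finset.mem_univ i)
  have : CompactSpace S := isCompact_iff_compactSpace.1 (Metric.isCompact_of_isClosed_isBounded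
    hScl hSbd)
  let L : Set C(S, ℝ) := {h | ∃ g w, PLValue x g w ∧ ∀ s : S, h s = g s}
  have hsup : ∀ h₁ ∈ L, ∀ h₂ ∈ L, h₁ ⊔ h₂ ∈ L := by
    rintro h₁ ⟨g₁, w₁, hg₁, e₁⟩ h₂ ⟨g₂, w₂, hg₂, e₂⟩
    exact ⟨_, _, hg₁.sup hg₂, fun s => by simp [e₁, e₂]⟩
  have hinf : ∀ h₁ ∈ L, ∀ h₂ ∈ L, h₁ ⊓ h₂ ∈ L := by
    rintro h₁ ⟨g₁, w₁, hg₁, e₁⟩ h₂ ⟨g₂, w₂, hg₂, e₂⟩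
    exact ⟨_, _, (hg₁.neg.sup hg₂.neg).neg, fun s => by simp [e₁, e₂, max_neg_neg]⟩
  have hmk : ∀ g w, PLValue x g w → ∃ h ∈ L, ∀ s : S, h s = g s := fun g w hg =>
    ⟨⟨fun s => g s, hg.continuous.comp continuous_subtype_val⟩, ⟨g, w, hg, fun _ => rfl⟩,
      fun _ => rfl⟩
  have hsep : L.SeparatesPointsStrongly := by
    intro v p r
    by_cases hpr : p = r
    · subst hpr
      obtain ⟨h, hL, hh⟩ := hmk _ _ ((PLValue.linear x p.1).smul (v p))
      refine ⟨h, hL, ?_⟩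
      have : ∑ i, p.1 i * p.1 i = 1 := by
        have hp : ∑ i, p.1 i ^ 2 = 1 := p.2
        simpa only [sq] using hp
      constructor <;> rw [hh, this, mul_one]
    · have bump : ∀ p r : S, p ≠ r → ∃ g w, PLValue x g w ∧ g p.1 = 1 ∧ g r.1 = 0 := by
        intro p r hpr
        have h1 := PLValue.linear x (p.1 - r.1)
        have hz := PLValue.linear x 0
        have h2 := h1.sup hz
        have hp : ∑ i, p.1 i ^ 2 = 1 := p.2
        have hr : ∑ i, r.1 i ^ 2 = 1 := r.2
        have hpos : 0 < ∑ i, (p.1 i - r.1 i) ^ 2 := by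
          obtain ⟨i, hi⟩ := Function.ne_iff.1 (fun h => hpr (Subtype.ext h))
          exact Finset.sum_pos' (fun i _ => sq_nonneg _)
            ⟨i, Finset.mem_univ i, by have := sub_ne_zero.2 hi; positivity⟩
        have e1 : ∑ i, (p.1 - r.1) i * p.1 i = (∑ i, (p.1 i - r.1 i) ^ 2) / 2 := by
          have : ∑ i, (p.1 i - r.1 i) ^ 2 = ∑ i, (2 * ((p.1 - r.1) i * p.1 i)
            - p.1 i ^ 2 + r.1 i ^ 2) := Finset.sum_congr rfl fun i _ => by simp; ring
          rw [this, Finset.sum_add_distrib, Finset.sum_sub_distrib, ← Finset.mul_sum, hp, hr]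
          ring
        have e2 : ∑ i, (p.1 - r.1) i * r.1 i = -((∑ i, (p.1 i - r.1 i) ^ 2) / 2) := by
          have : ∑ i, (p.1 i - r.1 i) ^ 2 = ∑ i, (-2 * ((p.1 - r.1) i * r.1 i)
            + p.1 i ^ 2 - r.1 i ^ 2) := Finset.sum_congr rfl fun i _ => by simp; ring
          rw [this, Finset.sum_sub_distrib, Finset.sum_add_distrib, ← Finset.mul_sum, hp, hr]
          ring
        refine ⟨_, _, h2.smul ((∑ i, (p.1 i - r.1 i) ^ 2) / 2)⁻¹, ?_, ?_⟩
        · simp only [e1, Pi.zero_apply, zero_mul, Finset.sum_const_zero]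
          rw [sup_eq_left.2 (by positivity), inv_mul_cancel₀ (by positivity)]
        · simp only [e2, Pi.zero_apply, zero_mul, Finset.sum_const_zero]
          rw [sup_eq_right.2 (by linarith), mul_zero]
      obtain ⟨g₁, w₁, hg₁, a₁, b₁⟩ := bump p r hpr
      obtain ⟨g₂, w₂, hg₂, a₂, b₂⟩ := bump r p (Ne.symm hpr)
      obtain ⟨h, hL, hh⟩ := hmk _ _ ((hg₁.smul (v p)).add (hg₂.smul (v r)))
      exact ⟨h, hL, by simp [hh, a₁, b₂], by simp [hh, a₂, b₁]⟩
  have hne : L.Nonempty := by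
    obtain ⟨h, hL, _⟩ := hmk _ _ (PLValue.linear x 0)
    exact ⟨h, hL⟩
  have hcl := ContinuousMap.sublattice_closure_eq_top L hne hinf hsup hsep
  have hfm : (⟨fun s : S => f.1 s, f.1.continuous.comp continuous_subtype_val⟩ : C(S, ℝ)) ∈
      closure L := by rw [hcl]; trivial
  obtain ⟨h, ⟨g, w, hg, e⟩, hd⟩ := Metric.mem_closure_iff.1 hfm ε hε
  refine ⟨g, w, hg, fun t => ?_⟩
  rcases eq_or_ne (∑ i, t i ^ 2) 0 with h0 | h0
  · have ht : t = 0 := by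
      funext i
      have := (Finset.sum_eq_zero_iff_of_nonneg (fun i _ => sq_nonneg (t i))).1 h0 i
        (Finset.mem_univ i)
      simpa using this
    have hf0 : f.1 0 = 0 := by simpa using f.2 0 le_rfl 0
    have hg0 : g 0 = 0 := by
      have := hg.homog two_pos (0 : Fin n → ℝ)
      rw [smul_zero] at this
      linarith
    rw [ht, hf0, hg0, sub_zero, abs_zero]
    exact mul_nonneg hε.le (maxLin_signs_nonneg _)
  · set N := √(∑ i, t i ^ 2) with hN
    have hpos : 0 < N := Real.sqrt_pos.2 (lt_of_le_of_ne (Finset.sum_nonneg fun i _ => sq_nonneg _)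
      (Ne.symm h0))
    have hmem : N⁻¹ • t ∈ S := by
      show ∑ i, (N⁻¹ • t) i ^ 2 = 1
      simp only [Pi.smul_apply, smul_eq_mul, mul_pow, ← Finset.mul_sum]
      rw [← Real.sq_sqrt (Finset.sum_nonneg fun i _ => sq_nonneg (t i)), ← hN, ← mul_pow,
        inv_mul_cancel₀ hpos.ne', one_pow]
    have h1 := (ContinuousMap.dist_apply_le_dist (⟨N⁻¹ • t, hmem⟩ : S)).trans hd.le
    rw [e] at h1
    have h1' : |f.1 (N⁻¹ • t) - g (N⁻¹ • t)| ≤ ε := h1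
    rw [f.2 _ (inv_pos.2 hpos).le, hg.homog (inv_pos.2 hpos), ← mul_sub, abs_mul,
      abs_of_pos (inv_pos.2 hpos), inv_mul_le_iff₀ hpos] at h1'
    calc _ ≤ N * ε := h1'
      _ = ε * N := mul_comm _ _
      _ ≤ _ := mul_le_mul_of_nonneg_left (sqrt_le_maxLin_signs t) hε.le

variable [HasSolidNorm E]

theorem le_of_forall_pos_smul {v w q : E} (h : ∀ ε : ℝ, 0 < ε → v ≤ w + ε • q) : v ≤ w := by
  have ht : Filter.Tendsto (fun ε : ℝ => w + ε • q) (nhdsWithin 0 (Set.Ioi 0)) (nhds w) := by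
    have : Filter.Tendsto (fun ε : ℝ => w + ε • q) (nhds 0) (nhds (w + (0 : ℝ) • q)) :=
      (by fun_prop : Continuous fun ε : ℝ => w + ε • q).tendsto 0
    rw [zero_smul, add_zero] at this
    exact this.mono_left nhdsWithin_le_nhds
  exact ge_of_tendsto ht (Filter.eventually_of_mem self_mem_nhdsWithin fun ε hε => h ε hε)

/-- `v` is the value at `x` of the uniform limit `f` of piecewise linear functions. -/
def Val (x : Fin n → E) (f : (Fin n → ℝ) → ℝ) (v : E) : Prop :=
  ∀ ε : ℝ, 0 < ε → ∃ g w, PLValue x g w ∧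
    (∀ t, |f t - g t| ≤ ε * maxLin (signs n) (signs_nonempty n) t) ∧
    |v - w| ≤ ε • maxLin (signs n) (signs_nonempty n) x

theorem PLValue.val (hf : PLValue x f v) : Val x f v := fun ε hε =>
  ⟨f, v, hf, fun t => by simpa using mul_nonneg hε.le (maxLin_signs_nonneg t), by
    simpa using smul_nonneg hε.le (maxLin_signs_nonneg x)⟩

theorem Val.mono (hf : Val x f v) (hg : Val x g w) (h : ∀ t, f t ≤ g t) : v ≤ w := by
  refine le_of_forall_pos_smul (q := maxLin (signs n) (signs_nonempty n) x) fun ε hε => ?_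
  obtain ⟨f', v', hf', h1, h2⟩ := hf (ε / 4) (by positivity)
  obtain ⟨g', w', hg', h3, h4⟩ := hg (ε / 4) (by positivity)
  have h5 : v' ≤ w' + (ε / 2) • maxLin (signs n) (signs_nonempty n) x := by
    refine hf'.mono (hg'.add ((plValue_signs x).smul (ε / 2))) fun t => ?_
    have := abs_le.1 (h1 t)
    have := abs_le.1 (h3 t)
    have := h t
    linarith
  have h6 := (le_abs_self _).trans h2
  have h7 := (neg_le_abs _).trans h4
  calc v = (v - v') + v' := by abel
    _ ≤ (ε / 4) • maxLin (signs n) (signs_nonempty n) x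
        + (w' + (ε / 2) • maxLin (signs n) (signs_nonempty n) x) := add_le_add h6 h5
    _ = w + -(w - w') + (3 * ε / 4) • maxLin (signs n) (signs_nonempty n) x := by
        module
    _ ≤ w + (ε / 4) • maxLin (signs n) (signs_nonempty n) x
        + (3 * ε / 4) • maxLin (signs n) (signs_nonempty n) x := by gcongr
    _ = _ := by module

theorem Val.unique (hf : Val x f v) (hg : Val x f w) : v = w :=
  le_antisymm (hf.mono hg fun _ => le_rfl) (hg.mono hf fun _ => le_rfl)

theorem Val.add (hf : Val x f v) (hg : Val x g w) : Val x (fun t => f t + g t) (v + w) := by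
  intro ε hε
  obtain ⟨f', v', hf', h1, h2⟩ := hf (ε / 2) (by positivity)
  obtain ⟨g', w', hg', h3, h4⟩ := hg (ε / 2) (by positivity)
  refine ⟨_, _, hf'.add hg', fun t => ?_, ?_⟩
  · rw [add_sub_add_comm]
    refine (abs_add_le _ _).trans ((add_le_add (h1 t) (h3 t)).trans (le_of_eq ?_))
    ring
  · rw [add_sub_add_comm]
    refine (abs_add_le _ _).trans ((add_le_add h2 h4).trans (le_of_eq ?_))
    module

theorem Val.sup (hf : Val x f v) (hg : Val x g w) : Val x (fun t => f t ⊔ g t) (v ⊔ w) := by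
  have key : ∀ {F : Type _} [AddCommGroup F] [Lattice F] [IsOrderedAddMonoid F] (a b c d : F),
      |a ⊔ b - c ⊔ d| ≤ |a - c| + |b - d| := by
    intro F _ _ _ a b c d
    calc |a ⊔ b - c ⊔ d| = |a ⊔ b - c ⊔ b + (c ⊔ b - c ⊔ d)| := by rw [sub_add_sub_cancel]
      _ ≤ |a ⊔ b - c ⊔ b| + |c ⊔ b - c ⊔ d| := abs_add_le _ _
      _ ≤ |a - c| + |b - d| := by
        refine add_le_add (abs_sup_sub_sup_le_abs _ _ _) ?_
        rw [sup_comm c, sup_comm c]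
        exact abs_sup_sub_sup_le_abs _ _ _
  intro ε hε
  obtain ⟨f', v', hf', h1, h2⟩ := hf (ε / 2) (by positivity)
  obtain ⟨g', w', hg', h3, h4⟩ := hg (ε / 2) (by positivity)
  refine ⟨_, _, hf'.sup hg', fun t => ?_, ?_⟩
  · refine (abs_max_sub_max_le_max _ _ _ _).trans (max_le ?_ ?_)
    · have := maxLin_signs_nonneg t
      exact (h1 t).trans (by nlinarith)
    · have := maxLin_signs_nonneg t
      exact (h3 t).trans (by nlinarith)
  · refine (key _ _ _ _).trans ((add_le_add h2 h4).trans (le_of_eq ?_))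
    module

theorem abs_real_smul (c : ℝ) (v : E) : |c • v| = |c| • |v| := by
  have key : ∀ (c : ℝ) (v : E), |c • v| ≤ |c| • |v| := by
    intro c v
    rw [abs_le']
    rcases le_total 0 c with h | h
    · rw [abs_of_nonneg h, ← smul_neg]
      exact ⟨smul_le_smul_of_nonneg_left (le_abs_self v) h,
        smul_le_smul_of_nonneg_left (neg_le_abs v) h⟩
    · rw [abs_of_nonpos h, ← neg_smul]
      refine ⟨?_, smul_le_smul_of_nonneg_left (le_abs_self v) (neg_nonneg.2 h)⟩
      rw [← neg_smul_neg c v]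
      exact smul_le_smul_of_nonneg_left (neg_le_abs v) (neg_nonneg.2 h)
  refine le_antisymm (key c v) ?_
  rcases eq_or_ne c 0 with rfl | hc
  · simp
  have h := smul_le_smul_of_nonneg_left (key c⁻¹ (c • v)) (abs_nonneg c)
  rwa [smul_smul, inv_mul_cancel₀ hc, one_smul, smul_smul, ← abs_mul, mul_inv_cancel₀ hc, abs_one,
    one_smul] at h

theorem Val.smul (hf : Val x f v) (c : ℝ) : Val x (fun t => c * f t) (c • v) := by
  intro ε hε
  have hc : 0 < |c| + 1 := by positivity
  obtain ⟨f', v', hf', h1, h2⟩ := hf (ε / (|c| + 1)) (by positivity)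
  have hle : |c| * (ε / (|c| + 1)) ≤ ε := by
    rw [mul_div_assoc', div_le_iff₀ hc]
    nlinarith [abs_nonneg c]
  refine ⟨_, _, hf'.smul c, fun t => ?_, ?_⟩
  · rw [← mul_sub, abs_mul]
    calc _ ≤ |c| * (ε / (|c| + 1) * maxLin (signs n) (signs_nonempty n) t) :=
          mul_le_mul_of_nonneg_left (h1 t) (abs_nonneg c)
      _ ≤ _ := by
          rw [← mul_assoc]
          exact mul_le_mul_of_nonneg_right hle (maxLin_signs_nonneg t)
  · rw [← smul_sub, abs_real_smul]
    calc _ ≤ |c| • (ε / (|c| + 1)) • maxLin (signs n) (signs_nonempty n) x :=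
          smul_le_smul_of_nonneg_left h2 (abs_nonneg c)
      _ ≤ _ := by
          rw [smul_smul]
          exact smul_le_smul_of_nonneg_right hle (maxLin_signs_nonneg x)

theorem exists_val [CompleteSpace E] (x : Fin n → E) (f : PosHom n) : ∃ v, Val x f.1 v := by
  set q := maxLin (signs n) (signs_nonempty n) x with hq
  have hq0 : 0 ≤ q := maxLin_signs_nonneg x
  choose g w hgw hg using fun k : ℕ => exists_plValue_approx x f
    (show (0 : ℝ) < (1 / 2) ^ k by positivity)
  have hdiff : ∀ k l, |w k - w l| ≤ ((1 / 2 : ℝ) ^ k + (1 / 2) ^ l) • q := by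
    intro k l
    have hk := fun t => abs_le.1 (hg k t)
    have hl := fun t => abs_le.1 (hg l t)
    rw [abs_le']
    constructor
    · rw [sub_le_iff_le_add]
      refine (hgw k).mono (((plValue_signs x).smul _).add (hgw l)) fun t => ?_
      linarith [hk t, hl t]
    · rw [neg_sub, sub_le_iff_le_add]
      refine (hgw l).mono (((plValue_signs x).smul _).add (hgw k)) fun t => ?_
      linarith [hk t, hl t]
  have hcau : CauchySeq w := by
    refine cauchySeq_of_le_geometric (1 / 2) (2 * ‖q‖) (by norm_num) fun k => ?_
    rw [dist_eq_norm]
    have h1 := norm_le_norm_of_abs_le_abs ((hdiff k (k + 1)).trans (le_abs_self _))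
    rw [norm_smul, Real.norm_of_nonneg (by positivity)] at h1
    refine h1.trans ?_
    rw [mul_comm (2 * ‖q‖), ← mul_assoc]
    refine mul_le_mul_of_nonneg_right ?_ (norm_nonneg q)
    rw [pow_succ]
    have : (0 : ℝ) < (1 / 2) ^ k := by positivity
    linarith
  obtain ⟨v, hv⟩ := cauchySeq_tendsto_of_complete hcau
  have hlim : ∀ l, |v - w l| ≤ ((1 / 2 : ℝ) ^ l) • q := by
    intro l
    have h1 : Filter.Tendsto (fun k => ((1 / 2 : ℝ) ^ k + (1 / 2) ^ l) • q) Filter.atTop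
        (nhds (((0 : ℝ) + (1 / 2) ^ l) • q)) :=
      ((tendsto_pow_atTop_nhds_zero_of_lt_one (by norm_num) (by norm_num)).add
        tendsto_const_nhds).smul_const q
    rw [zero_add] at h1
    have h2 : Filter.Tendsto (fun k => w k - w l) Filter.atTop (nhds (v - w l)) :=
      hv.sub tendsto_const_nhds
    rw [abs_le']
    exact ⟨le_of_tendsto_of_tendsto' h2 h1 fun k => (le_abs_self _).trans (hdiff k l),
      le_of_tendsto_of_tendsto' h2.neg h1 fun k => (neg_le_abs _).trans (hdiff k l)⟩
  refine ⟨v, fun ε hε => ?_⟩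
  obtain ⟨k, hk⟩ := exists_pow_lt_of_lt_one hε (show (1 / 2 : ℝ) < 1 by norm_num)
  exact ⟨g k, w k, hgw k, fun t => (hg k t).trans
    (mul_le_mul_of_nonneg_right hk.le (maxLin_signs_nonneg t)),
    (hlim k).trans (smul_le_smul_of_nonneg_right hk.le hq0)⟩

/-- The coordinate function `t ↦ t i`. -/
def PosHom.coord (i : Fin n) : PosHom n :=
  ⟨⟨fun t => t i, continuous_apply i⟩, fun c _ t => by simp⟩

/-- The pointwise maximum of two positively homogeneous functions. -/
def PosHom.max (f g : PosHom n) : PosHom n :=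
  ⟨f.1 ⊔ g.1, fun c hc t => by
    simp [f.2 c hc t, g.2 c hc t, mul_max_of_nonneg _ _ hc]⟩

/-- `τ` is a functional calculus for the tuple `x`: a linear map on the positively homogeneous
continuous functions that preserves the lattice operations and sends the `i`-th coordinate function
to `x i`. -/
structure IsKrivineCalculus (x : Fin n → E) (τ : PosHom n →ₗ[ℝ] E) : Prop where
  map_coord : ∀ i, τ (PosHom.coord i) = x i
  map_max : ∀ f g, τ (PosHom.max f g) = τ f ⊔ τ g

theorem IsKrivineCalculus.mono {τ : PosHom n →ₗ[ℝ] E} (hτ : IsKrivineCalculus x τ)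
    {f g : PosHom n} (h : ∀ t, f.1 t ≤ g.1 t) : τ f ≤ τ g := by
  have : PosHom.max f g = g := Subtype.ext (ContinuousMap.ext fun t => sup_eq_right.2 (h t))
  rw [← sup_eq_right, ← hτ.map_max, this]

theorem IsKrivineCalculus.val {τ : PosHom n →ₗ[ℝ] E} (hτ : IsKrivineCalculus x τ)
    (f : PosHom n) : Val x f.1 (τ f) := by
  have hmax : ∀ (a : Finset (Fin n → ℝ)) (ha : a.Nonempty),
      ∃ p : PosHom n, (∀ t, p.1 t = maxLin a ha t) ∧ τ p = maxLin a ha x := by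
    intro a ha
    induction ha using Finset.Nonempty.cons_induction with
    | singleton α =>
      refine ⟨∑ i, α i • PosHom.coord i, fun t => ?_, ?_⟩
      · simp [maxLin, PosHom.coord]
      · simp [maxLin, hτ.map_coord]
    | cons α s h hs ih =>
      obtain ⟨p, hp, hp'⟩ := ih
      refine ⟨PosHom.max (∑ i, α i • PosHom.coord i) p, fun t => ?_, ?_⟩
      · simp only [maxLin, Finset.sup'_cons hs]
        rw [← maxLin, ← hp]
        simp [PosHom.max, PosHom.coord]
      · simp only [maxLin, Finset.sup'_cons hs]
        rw [← maxLin, ← hp', hτ.map_max]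
        simp [hτ.map_coord]
  have hpl : ∀ g w, PLValue x g w → ∃ p : PosHom n, (∀ t, p.1 t = g t) ∧ τ p = w := by
    rintro g w ⟨a, ha, b, hb, hg, rfl⟩
    obtain ⟨p, hp, hp'⟩ := hmax a ha
    obtain ⟨r, hr, hr'⟩ := hmax b hb
    exact ⟨p - r, fun t => by simp [hp, hr, hg], by simp [hp', hr']⟩
  intro ε hε
  obtain ⟨g, w, hgw, hg⟩ := exists_plValue_approx x f hε
  obtain ⟨p, hp, hp'⟩ := hpl g w hgw
  obtain ⟨r, hr, hr'⟩ := hpl _ _ ((plValue_signs x).smul ε)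
  refine ⟨g, w, hgw, hg, ?_⟩
  have hg' := fun t => abs_le.1 (hg t)
  rw [← hp', ← hr', ← map_sub, abs_le', ← map_neg]
  constructor
  · refine hτ.mono fun t => ?_
    have := hg' t
    simp only [Submodule.coe_sub, ContinuousMap.sub_apply, hp, hr]
    linarith
  · refine hτ.mono fun t => ?_
    have := hg' t
    simp only [Submodule.coe_neg, Submodule.coe_sub, ContinuousMap.sub_apply,
      ContinuousMap.neg_apply, hp, hr]
    linarith

/-- Existence and uniqueness of the Krivine functional calculus. -/
theorem existsUnique_krivineCalculus [CompleteSpace E] (x : Fin n → E) :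
    ∃! τ : PosHom n →ₗ[ℝ] E, IsKrivineCalculus x τ := by
  choose v hv using fun f : PosHom n => exists_val x f
  refine ⟨{ toFun := v, map_add' := fun f g => ?_, map_smul' := fun c f => ?_ },
    ⟨fun i => ?_, fun f g => ?_⟩, fun τ hτ => ?_⟩
  · exact (hv (f + g)).unique ((hv f).add (hv g))
  · exact (hv (c • f)).unique ((hv f).smul c)
  · have h := (PLValue.linear x (Pi.single i 1)).val
    simp only [Pi.single_apply, ite_mul, one_mul, zero_mul, ite_smul, one_smul, zero_smul,
      Finset.sum_ite_eq', Finset.mem_univ, if_true] at h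
    exact (hv (PosHom.coord i)).unique h
  · exact (hv (PosHom.max f g)).unique ((hv f).sup (hv g))
  · ext f
    exact (hτ.val f).unique (hv f)

/-- The Krivine functional calculus of the tuple `x`: `krivine x f` is `f (x₁, …, xₙ)`. -/
def krivine [CompleteSpace E] (x : Fin n → E) : PosHom n →ₗ[ℝ] E :=
  (existsUnique_krivineCalculus x).choose

theorem isKrivineCalculus_krivine [CompleteSpace E] (x : Fin n → E) :
    IsKrivineCalculus x (krivine x) :=
  (existsUnique_krivineCalculus x).choose_spec.1

end Krivine
open Function

section Partitions

variable {m : ℕ} {E : Type*} [AddCommGroup E] [Lattice E] [IsOrderedAddMonoid E]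

/-- Subadditivity on the positive cone, with value zero at the origin. -/
structure IsConeSubadd (h : E → ℝ) : Prop where
  zero : h 0 = 0
  add_le : ∀ a b, 0 ≤ a → 0 ≤ b → h (a + b) ≤ h a + h b

/-- The sums of `h` over the finite partitions of `a` into positive vectors. -/
def partitionSums (h : E → ℝ) (a : E) : Set ℝ :=
  {r | ∃ l : List E, (∀ u ∈ l, 0 ≤ u) ∧ l.sum = a ∧ (l.map h).sum = r}

theorem mem_partitionSums (h : E → ℝ) {a : E} (ha : 0 ≤ a) : h a ∈ partitionSums h a :=
  ⟨[a], by simpa using ha, by simp, by simp⟩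

theorem list_sum_nonneg' {l : List E} (hl : ∀ u ∈ l, 0 ≤ u) : 0 ≤ l.sum := List.sum_nonneg hl

theorem exists_split (l : List E) : ∀ (a b : E), 0 ≤ a → 0 ≤ b → (∀ u ∈ l, 0 ≤ u) → l.sum = a + b →
    ∃ l₁ l₂ : List E, (∀ u ∈ l₁, 0 ≤ u) ∧ (∀ u ∈ l₂, 0 ≤ u) ∧ l₁.sum = a ∧ l₂.sum = b ∧
      ∀ h : E → ℝ, IsConeSubadd h → (l.map h).sum ≤ (l₁.map h).sum + (l₂.map h).sum := by
  induction l with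
  | nil =>
    intro a b ha hb _ hs
    have hs' : a + b = 0 := by simpa using hs.symm
    have h0 := (add_eq_zero_iff_of_nonneg ha hb).1 hs'
    exact ⟨[], [], by simp, by simp, by simp [h0.1], by simp [h0.2], by simp⟩
  | cons c l ih =>
    intro a b ha hb hl hs
    have hc : 0 ≤ c := hl c (by simp)
    have hl' : ∀ u ∈ l, 0 ≤ u := fun u hu => hl u (by simp [hu])
    have hls := list_sum_nonneg' hl'
    rw [List.sum_cons] at hs
    have hcab : c ≤ a + b := by rw [← hs]; exact le_add_of_nonneg_right hls
    have h1 : 0 ≤ c ⊓ a := le_inf hc ha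
    have h2 : 0 ≤ c - c ⊓ a := sub_nonneg.2 inf_le_left
    have h3 : 0 ≤ a - c ⊓ a := sub_nonneg.2 inf_le_right
    have h4 : 0 ≤ b - (c - c ⊓ a) := by
      have h5 : c - b ≤ c ⊓ a := le_inf (sub_le_self c hb) (by rwa [sub_le_iff_le_add])
      rw [sub_nonneg, sub_le_comm]
      exact h5
    obtain ⟨l₁, l₂, p₁, p₂, s₁, s₂, hh⟩ := ih (a - c ⊓ a) (b - (c - c ⊓ a)) h3 h4 hl' (by
      rw [← sub_eq_of_eq_add' hs.symm]; abel)
    refine ⟨c ⊓ a :: l₁, (c - c ⊓ a) :: l₂, ?_, ?_, ?_, ?_, fun h hh' => ?_⟩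
    · simpa using ⟨⟨hc, ha⟩, p₁⟩
    · intro u hu
      rcases List.mem_cons.1 hu with rfl | hu
      · exact h2
      · exact p₂ u hu
    · rw [List.sum_cons, s₁]; abel
    · rw [List.sum_cons, s₂]; abel
    · have e1 := hh h hh'
      have e2 := hh'.add_le _ _ h1 h2
      rw [add_sub_cancel] at e2
      simp only [List.map_cons, List.sum_cons]
      linarith

theorem IsConeSubadd.le_list {h : E → ℝ} (hh : IsConeSubadd h) {l : List E}
    (hl : ∀ u ∈ l, 0 ≤ u) : h l.sum ≤ (l.map h).sum := by
  induction l with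
  | nil => simp [hh.zero]
  | cons c l ih =>
    have hl' : ∀ u ∈ l, 0 ≤ u := fun u hu => hl u (by simp [hu])
    have := hh.add_le c l.sum (hl c (by simp)) (list_sum_nonneg' hl')
    simp only [List.map_cons, List.sum_cons]
    linarith [ih hl']

theorem exists_refinement (l₂ : List E) : ∀ l₁ : List E, (∀ u ∈ l₁, 0 ≤ u) → (∀ u ∈ l₂, 0 ≤ u) →
    l₁.sum = l₂.sum → ∃ l : List E, (∀ u ∈ l, 0 ≤ u) ∧ l.sum = l₂.sum ∧
      ∀ h : E → ℝ, IsConeSubadd h →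
        (l₁.map h).sum ≤ (l.map h).sum ∧ (l₂.map h).sum ≤ (l.map h).sum := by
  induction l₂ with
  | nil =>
    intro l₁ h₁ _ hs
    refine ⟨l₁, h₁, hs, fun h hh => ⟨le_rfl, ?_⟩⟩
    have := hh.le_list h₁
    rw [hs] at this
    simpa [hh.zero] using this
  | cons c l₂ ih =>
    intro l₁ h₁ h₂ hs
    have h₂' : ∀ u ∈ l₂, 0 ≤ u := fun u hu => h₂ u (by simp [hu])
    rw [List.sum_cons] at hs
    obtain ⟨k₁, k₂, p₁, p₂, s₁, s₂, hk⟩ := exists_split l₁ c l₂.sum (h₂ c (by simp))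
      (list_sum_nonneg' h₂') h₁ hs
    obtain ⟨l, hl, hls, hlh⟩ := ih k₂ p₂ h₂' s₂
    refine ⟨k₁ ++ l, ?_, by simp [s₁, hls], fun h hh => ?_⟩
    · intro u hu
      rcases List.mem_append.1 hu with hu | hu
      · exact p₁ u hu
      · exact hl u hu
    · have e1 := hk h hh
      have e2 := hlh h hh
      have e3 := hh.le_list p₁
      rw [s₁] at e3
      simp only [List.map_append, List.sum_append, List.map_cons, List.sum_cons]
      constructor <;> linarith

/-- The supremum of the sums of `h` over the finite partitions of `a`. -/
def partitionSup (h : E → ℝ) (a : E) : ℝ := sSup (partitionSums h a)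

theorem le_partitionSup {h : E → ℝ} {a : E} (hb : BddAbove (partitionSums h a)) {l : List E}
    (hl : ∀ u ∈ l, 0 ≤ u) (hs : l.sum = a) : (l.map h).sum ≤ partitionSup h a :=
  le_csSup hb ⟨l, hl, hs, rfl⟩

theorem partitionSup_le {h : E → ℝ} {a : E} (ha : 0 ≤ a) {r : ℝ}
    (H : ∀ l : List E, (∀ u ∈ l, 0 ≤ u) → l.sum = a → (l.map h).sum ≤ r) :
    partitionSup h a ≤ r := by
  refine csSup_le ⟨_, mem_partitionSums h ha⟩ ?_
  rintro _ ⟨l, hl, hs, rfl⟩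
  exact H l hl hs

theorem partitionSup_add {h : E → ℝ} (hh : IsConeSubadd h)
    (hb : ∀ a, 0 ≤ a → BddAbove (partitionSums h a)) {a b : E} (ha : 0 ≤ a) (hb' : 0 ≤ b) :
    partitionSup h (a + b) = partitionSup h a + partitionSup h b := by
  apply le_antisymm
  · refine partitionSup_le (add_nonneg ha hb') fun l hl hs => ?_
    obtain ⟨l₁, l₂, p₁, p₂, s₁, s₂, hk⟩ := exists_split l a b ha hb' hl hs
    exact (hk h hh).trans (add_le_add (le_partitionSup (hb a ha) p₁ s₁)
      (le_partitionSup (hb b hb') p₂ s₂))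
  · rw [← le_sub_iff_add_le]
    refine partitionSup_le ha fun l₁ p₁ s₁ => ?_
    rw [le_sub_comm]
    refine partitionSup_le hb' fun l₂ p₂ s₂ => ?_
    rw [le_sub_iff_add_le', ← List.sum_append, ← List.map_append]
    refine le_partitionSup (hb _ (add_nonneg ha hb')) (fun u hu => ?_) (by simp [s₁, s₂])
    rcases List.mem_append.1 hu with hu | hu
    · exact p₁ u hu
    · exact p₂ u hu

theorem list_map_add_sum (l : List E) (h k : E → ℝ) :
    (l.map fun u => h u + k u).sum = (l.map h).sum + (l.map k).sum := by
  induction l with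
  | nil => simp
  | cons c l ih => simp only [List.map_cons, List.sum_cons, ih]; ring

theorem list_map_le_sum {l : List E} {h k : E → ℝ} (H : ∀ u ∈ l, h u ≤ k u) :
    (l.map h).sum ≤ (l.map k).sum := List.sum_le_sum H

theorem partitionSup_fun_add {h k : E → ℝ} (hh : IsConeSubadd h) (hk : IsConeSubadd k) {a : E}
    (ha : 0 ≤ a) (bh : BddAbove (partitionSums h a)) (bk : BddAbove (partitionSums k a))
    (bhk : BddAbove (partitionSums (fun u => h u + k u) a)) :
    partitionSup (fun u => h u + k u) a = partitionSup h a + partitionSup k a := by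
  apply le_antisymm
  · refine partitionSup_le ha fun l hl hs => ?_
    rw [list_map_add_sum]
    exact add_le_add (le_partitionSup bh hl hs) (le_partitionSup bk hl hs)
  · rw [← le_sub_iff_add_le]
    refine partitionSup_le ha fun l₁ p₁ s₁ => ?_
    rw [le_sub_comm]
    refine partitionSup_le ha fun l₂ p₂ s₂ => ?_
    obtain ⟨l, hl, hs, hr⟩ := exists_refinement l₂ l₁ p₁ p₂ (s₁.trans s₂.symm)
    have := le_partitionSup bhk hl (hs.trans s₂)
    rw [list_map_add_sum] at this
    linarith [(hr h hh).1, (hr k hk).2]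

end Partitions

open Function

section Extension

variable {m : ℕ} {E : Type*} [AddCommGroup E] [Lattice E] [IsOrderedAddMonoid E] [Module ℝ E]
  [IsOrderedModule ℝ E]

/-- Positive homogeneity in each variable on the positive cone. -/
def ConeHomog (N : (Fin m → E) → ℝ) : Prop :=
  ∀ x, 0 ≤ x → ∀ k, ∀ c : ℝ, 0 ≤ c → ∀ a, 0 ≤ a → N (update x k (c • a)) = c * N (update x k a)

/-- Additivity in the variable `k` on the positive cone. -/
def ConeAdd (N : (Fin m → E) → ℝ) (k : Fin m) : Prop :=
  ∀ x, 0 ≤ x → ∀ a b, 0 ≤ a → 0 ≤ b →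
    N (update x k (a + b)) = N (update x k a) + N (update x k b)

/-- Subadditivity in the variable `k` on the positive cone. -/
def ConeSub (N : (Fin m → E) → ℝ) (k : Fin m) : Prop :=
  ∀ x, 0 ≤ x → ∀ a b, 0 ≤ a → 0 ≤ b →
    N (update x k (a + b)) ≤ N (update x k a) + N (update x k b)

theorem update_nonneg {x : Fin m → E} (hx : 0 ≤ x) (k : Fin m) {a : E} (ha : 0 ≤ a) :
    0 ≤ update x k a := by
  intro i
  rcases eq_or_ne i k with rfl | h
  · simpa using ha
  · simpa [h] using hx i

theorem ConeAdd.list_sum {M : (Fin m → E) → ℝ} {k : Fin m} (hM : ConeAdd M k) {x : Fin m → E}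
    (hx : 0 ≤ x) {l : List E} (hl : ∀ u ∈ l, 0 ≤ u) :
    (l.map fun u => M (update x k u)).sum = M (update x k l.sum) := by
  induction l with
  | nil =>
    have := hM x hx 0 0 le_rfl le_rfl
    rw [add_zero] at this
    simp only [List.map_nil, List.sum_nil]
    linarith
  | cons c l ih =>
    have hl' : ∀ u ∈ l, 0 ≤ u := fun u hu => hl u (by simp [hu])
    rw [List.map_cons, List.sum_cons, List.sum_cons, ih hl',
      hM x hx c l.sum (hl c (by simp)) (list_sum_nonneg' hl')]

theorem exists_least_coneAdd {N : (Fin m → E) → ℝ} (hh : ConeHomog N) (hs : ∀ k, ConeSub N k)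
    {B : (Fin m → E) → ℝ} (hB : ∀ k, ConeAdd B k) (hNB : ∀ x, 0 ≤ x → N x ≤ B x) :
    ∃ S : (Fin m → E) → ℝ, (∀ x, 0 ≤ x → N x ≤ S x) ∧ ConeHomog S ∧ (∀ k, ConeAdd S k) ∧
      ∀ M : (Fin m → E) → ℝ, (∀ k, ConeAdd M k) → (∀ x, 0 ≤ x → N x ≤ M x) →
        ∀ x, 0 ≤ x → S x ≤ M x := by
  have key : ∀ s : Finset (Fin m), ∃ S : (Fin m → E) → ℝ, (∀ x, 0 ≤ x → N x ≤ S x) ∧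
      ConeHomog S ∧ (∀ k, ConeSub S k) ∧ (∀ k ∈ s, ConeAdd S k) ∧
      ∀ M : (Fin m → E) → ℝ, (∀ k, ConeAdd M k) → (∀ x, 0 ≤ x → N x ≤ M x) →
        ∀ x, 0 ≤ x → S x ≤ M x := by
    intro s
    induction s using Finset.induction_on with
    | empty => exact ⟨N, fun _ _ => le_rfl, hh, hs, by simp, fun M _ hM => hM⟩
    | insert j s hj ih =>
      obtain ⟨S, hNS, hSh, hSs, hSa, hSl⟩ := ih
      have hsub : ∀ x, 0 ≤ x → IsConeSubadd fun u => S (update x j u) := fun x hx =>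
        ⟨by simpa using hSh x hx j 0 le_rfl 0 le_rfl, fun a b ha hb => hSs j x hx a b ha hb⟩
      have hle : ∀ M : (Fin m → E) → ℝ, (∀ k, ConeAdd M k) → (∀ x, 0 ≤ x → N x ≤ M x) →
          ∀ x, 0 ≤ x → ∀ l : List E, (∀ u ∈ l, 0 ≤ u) →
            (l.map fun u => S (update x j u)).sum ≤ M (update x j l.sum) := by
        intro M hM hNM x hx l hl
        rw [← (hM j).list_sum hx hl]
        exact list_map_le_sum fun u hu => hSl M hM hNM _ (update_nonneg hx j (hl u hu))
      have hbdd : ∀ x, 0 ≤ x → ∀ a, BddAbove (partitionSums (fun u => S (update x j u)) a) := by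
        intro x hx a
        refine ⟨B (update x j a), ?_⟩
        rintro _ ⟨l, hl, rfl, rfl⟩
        exact hle B hB hNB x hx l hl
      refine ⟨fun x => partitionSup (fun u => S (update x j u)) (x j), fun x hx => ?_, ?_, ?_, ?_,
        fun M hM hNM x hx => ?_⟩
      · refine (hNS x hx).trans ?_
        have := le_csSup (hbdd x hx (x j)) (mem_partitionSums _ (hx j))
        simp only [update_eq_self] at this
        exact this
      · intro x hx k c hc a ha
        rcases eq_or_ne k j with rfl | hkj
        · simp only [update_idem, update_self]
          rcases hc.eq_or_lt with rfl | hc'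
          · have := partitionSup_add (hsub x hx) (fun a _ => hbdd x hx a) (le_refl (0 : E)) le_rfl
            rw [add_zero] at this
            rw [zero_smul]
            linarith
          · have gen : ∀ (c : ℝ), 0 < c → ∀ a : E, 0 ≤ a →
                partitionSup (fun u => S (update x k u)) (c • a) ≤
                  c * partitionSup (fun u => S (update x k u)) a := by
              intro c hc a ha
              refine partitionSup_le (smul_nonneg hc.le ha) fun l hl hs => ?_
              have hl2 : ∀ u ∈ l.map (fun u => c⁻¹ • u), 0 ≤ u := by
                intro u hu
                obtain ⟨v, hv, rfl⟩ := List.mem_map.1 hu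
                exact smul_nonneg (inv_pos.2 hc).le (hl v hv)
              have := le_partitionSup (hbdd x hx a) hl2 (by
                rw [← List.smul_sum, hs, smul_smul, inv_mul_cancel₀ hc.ne', one_smul])
              rw [← inv_mul_le_iff₀ hc, ← List.sum_map_mul_left]
              refine le_trans (le_of_eq ?_) this
              rw [List.map_map]
              congr 1
              refine List.map_congr_left fun u hu => ?_
              simp only [comp_apply]
              rw [hSh x hx k _ (inv_pos.2 hc).le u (hl u hu)]
            refine le_antisymm (gen c hc' a ha) ?_
            have := gen c⁻¹ (inv_pos.2 hc') (c • a) (smul_nonneg hc ha)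
            rw [smul_smul, inv_mul_cancel₀ hc'.ne', one_smul] at this
            rwa [le_inv_mul_iff₀ hc'] at this
        · simp only [update_of_ne hkj.symm]
          have e : ∀ u, 0 ≤ u → S (update (update x k (c • a)) j u) =
              c * S (update (update x k a) j u) := by
            intro u hu
            rw [update_comm hkj, update_comm hkj]
            exact hSh _ (update_nonneg hx j hu) k c hc a ha
          have e2 : ∀ l : List E, (∀ u ∈ l, 0 ≤ u) →
              (l.map fun u => S (update (update x k (c • a)) j u)).sum =
                c * (l.map fun u => S (update (update x k a) j u)).sum := by
            intro l hl
            rw [← List.sum_map_mul_left]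
            exact congrArg _ (List.map_congr_left fun u hu => e u (hl u hu))
          apply le_antisymm
          · refine partitionSup_le (hx j) fun l hl hs => ?_
            rw [e2 l hl]
            exact mul_le_mul_of_nonneg_left
              (le_partitionSup (hbdd _ (update_nonneg hx k ha) _) hl hs) hc
          · rcases hc.eq_or_lt with rfl | hc'
            · rw [zero_mul]
              refine le_trans (le_of_eq ?_) (le_csSup
                (hbdd _ (update_nonneg hx k (smul_nonneg le_rfl ha)) _)
                (mem_partitionSums _ (hx j)))
              rw [e _ (hx j), zero_mul]
            · rw [← le_inv_mul_iff₀ hc']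
              refine partitionSup_le (hx j) fun l hl hs => ?_
              rw [le_inv_mul_iff₀ hc', ← e2 l hl]
              exact le_partitionSup (hbdd _ (update_nonneg hx k (smul_nonneg hc ha)) _) hl hs
      · intro k x hx a b ha hb
        rcases eq_or_ne k j with rfl | hkj
        · simp only [update_idem, update_self]
          exact (partitionSup_add (hsub x hx) (fun a _ => hbdd x hx a) ha hb).le
        · simp only [update_of_ne hkj.symm]
          refine partitionSup_le (hx j) fun l hl hs => ?_
          refine le_trans ?_ (add_le_add
            (le_partitionSup (hbdd _ (update_nonneg hx k ha) _) hl hs)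
            (le_partitionSup (hbdd _ (update_nonneg hx k hb) _) hl hs))
          rw [← list_map_add_sum]
          refine list_map_le_sum fun u hu => ?_
          rw [update_comm hkj, update_comm hkj, update_comm hkj]
          exact hSs k _ (update_nonneg hx j (hl u hu)) a b ha hb
      · intro k hk x hx a b ha hb
        rcases eq_or_ne k j with rfl | hkj
        · simp only [update_idem, update_self]
          exact partitionSup_add (hsub x hx) (fun a _ => hbdd x hx a) ha hb
        · have hks : k ∈ s := Finset.mem_of_mem_insert_of_ne hk hkj
          simp only [update_of_ne hkj.symm]
          have e : ∀ u, 0 ≤ u → S (update (update x k (a + b)) j u) =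
              S (update (update x k a) j u) + S (update (update x k b) j u) := by
            intro u hu
            rw [update_comm hkj, update_comm hkj, update_comm hkj]
            exact hSa k hks _ (update_nonneg hx j hu) a b ha hb
          have e2 : partitionSums (fun u => S (update (update x k (a + b)) j u)) (x j) =
              partitionSums (fun u => S (update (update x k a) j u) +
                S (update (update x k b) j u)) (x j) := by
            ext r
            constructor
            · rintro ⟨l, hl, hs, rfl⟩
              exact ⟨l, hl, hs, congrArg _ (List.map_congr_left fun u hu => (e u (hl u hu)).symm)⟩
            · rintro ⟨l, hl, hs, rfl⟩
              exact ⟨l, hl, hs, congrArg _ (List.map_congr_left fun u hu => e u (hl u hu))⟩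
          have hab := hbdd _ (update_nonneg hx k (add_nonneg ha hb)) (x j)
          unfold partitionSup
          rw [e2] at hab ⊢
          exact partitionSup_fun_add (hsub _ (update_nonneg hx k ha))
            (hsub _ (update_nonneg hx k hb)) (hx j) (hbdd _ (update_nonneg hx k ha) _)
            (hbdd _ (update_nonneg hx k hb) _) hab
      · refine partitionSup_le (hx j) fun l hl hs => ?_
        have := hle M hM hNM x hx l hl
        rwa [hs, update_eq_self] at this
  obtain ⟨S, h1, h2, _, h4, h5⟩ := key Finset.univ
  exact ⟨S, h1, h2, fun k => h4 k (Finset.mem_univ k), h5⟩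

theorem posPart_real_smul {c : ℝ} (hc : 0 ≤ c) (a : E) : (c • a)⁺ = c • a⁺ := by
  rcases hc.eq_or_lt with rfl | hc'
  · simp
  have key : ∀ (c : ℝ), 0 < c → ∀ a : E, (c • a)⁺ ≤ c • a⁺ := fun c hc a =>
    sup_le (smul_le_smul_of_nonneg_left (le_posPart a) hc.le)
      (smul_nonneg hc.le (posPart_nonneg a))
  refine le_antisymm (key c hc' a) ?_
  have := smul_le_smul_of_nonneg_left (key c⁻¹ (inv_pos.2 hc') (c • a)) hc
  rwa [smul_smul, inv_mul_cancel₀ hc'.ne', one_smul, smul_smul, mul_inv_cancel₀ hc'.ne',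
    one_smul] at this

theorem negPart_real_smul {c : ℝ} (hc : 0 ≤ c) (a : E) : (c • a)⁻ = c • a⁻ := by
  rw [← posPart_neg, ← posPart_neg, ← smul_neg, posPart_real_smul hc]

/-- A positively homogeneous additive function on the cone extends to a linear function. -/
theorem cone_extend {h : E → ℝ} (ha : ∀ a b, 0 ≤ a → 0 ≤ b → h (a + b) = h a + h b)
    (hm : ∀ c : ℝ, 0 ≤ c → ∀ a, 0 ≤ a → h (c • a) = c * h a) :
    (∀ a b, h (a + b)⁺ - h (a + b)⁻ = (h a⁺ - h a⁻) + (h b⁺ - h b⁻)) ∧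
    (∀ (c : ℝ) (a : E), h (c • a)⁺ - h (c • a)⁻ = c * (h a⁺ - h a⁻)) ∧
    (∀ a, 0 ≤ a → h a⁺ - h a⁻ = h a) := by
  refine ⟨fun a b => ?_, fun c a => ?_, fun a ha0 => ?_⟩
  · have e : (a + b)⁺ + (a⁻ + b⁻) = (a + b)⁻ + (a⁺ + b⁺) := by
      have h1 := posPart_sub_negPart (a + b)
      have h2 := posPart_sub_negPart a
      have h3 := posPart_sub_negPart b
      rw [sub_eq_iff_eq_add] at h1
      rw [h1]
      nth_rw 1 [← h2, ← h3]
      abel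
    have e' := congrArg h e
    rw [ha _ _ (posPart_nonneg _) (add_nonneg (negPart_nonneg _) (negPart_nonneg _)),
      ha _ _ (negPart_nonneg _) (negPart_nonneg _),
      ha _ _ (negPart_nonneg _) (add_nonneg (posPart_nonneg _) (posPart_nonneg _)),
      ha _ _ (posPart_nonneg _) (posPart_nonneg _)] at e'
    linarith
  · rcases le_total 0 c with hc | hc
    · rw [posPart_real_smul hc, negPart_real_smul hc, hm c hc _ (posPart_nonneg _),
        hm c hc _ (negPart_nonneg _)]
      ring
    · have hc' : 0 ≤ -c := neg_nonneg.2 hc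
      have e1 : (c • a)⁺ = (-c) • a⁻ := by
        rw [← neg_smul_neg, posPart_real_smul hc', posPart_neg]
      have e2 : (c • a)⁻ = (-c) • a⁺ := by
        rw [← neg_smul_neg, negPart_real_smul hc', negPart_neg]
      rw [e1, e2, hm _ hc' _ (posPart_nonneg _), hm _ hc' _ (negPart_nonneg _)]
      ring
  · have h0 : h 0 = 0 := by
      have := ha 0 0 le_rfl le_rfl
      rw [add_zero] at this
      linarith
    rw [posPart_of_nonneg ha0, negPart_of_nonneg ha0, h0, sub_zero]

theorem exists_multilinear_extension {S : (Fin m → E) → ℝ} (hh : ConeHomog S)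
    (ha : ∀ k, ConeAdd S k) :
    ∃ A : MultilinearMap ℝ (fun _ : Fin m => E) ℝ, ∀ x, 0 ≤ x → A x = S x := by
  have key : ∀ s : Finset (Fin m), ∃ S' : (Fin m → E) → ℝ, (∀ x, 0 ≤ x → S' x = S x) ∧
      (∀ x, (∀ i ∉ s, 0 ≤ x i) → ∀ k, ∀ a b, (k ∉ s → 0 ≤ a ∧ 0 ≤ b) →
        S' (update x k (a + b)) = S' (update x k a) + S' (update x k b)) ∧
      (∀ x, (∀ i ∉ s, 0 ≤ x i) → ∀ k, ∀ (c : ℝ) (a : E), (k ∉ s → 0 ≤ c ∧ 0 ≤ a) →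
        S' (update x k (c • a)) = c * S' (update x k a)) := by
    intro s
    induction s using Finset.induction_on with
    | empty =>
      exact ⟨S, fun _ _ => rfl,
        fun x hx k a b hab => ha k x (fun i => hx i (by simp)) a b (hab (by simp)).1
          (hab (by simp)).2,
        fun x hx k c a hca => hh x (fun i => hx i (by simp)) k c (hca (by simp)).1 a
          (hca (by simp)).2⟩
    | insert j s hj ih =>
      obtain ⟨S', hS, hA, hH⟩ := ih
      have hupd : ∀ x : Fin m → E, (∀ i ∉ insert j s, 0 ≤ x i) → ∀ u, 0 ≤ u →
          ∀ i ∉ s, 0 ≤ update x j u i := by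
        intro x hx u hu i hi
        rcases eq_or_ne i j with rfl | hij
        · simpa using hu
        · rw [update_of_ne hij]
          exact hx i (by simp [hi, hij])
      have hone := fun (x : Fin m → E) (hx : ∀ i ∉ insert j s, 0 ≤ x i) =>
        cone_extend (h := fun u => S' (update x j u))
          (fun a b ha hb => by
            have := hA (update x j 0) (hupd x hx 0 le_rfl) j a b fun _ => ⟨ha, hb⟩
            simpa using this)
          (fun c hc a ha => by
            have := hH (update x j 0) (hupd x hx 0 le_rfl) j c a fun _ => ⟨hc, ha⟩
            simpa using this)
      refine ⟨fun x => S' (update x j (x j)⁺) - S' (update x j (x j)⁻), fun x hx => ?_,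
        fun x hx k a b hab => ?_, fun x hx k c a hca => ?_⟩
      · have := (hone x fun i _ => hx i).2.2 (x j) (hx j)
        simp only [update_eq_self] at this
        exact this.trans (hS x hx)
      · rcases eq_or_ne k j with rfl | hkj
        · simp only [update_idem, update_self]
          exact (hone x hx).1 a b
        · simp only [update_of_ne hkj.symm]
          have hks : k ∉ s → 0 ≤ a ∧ 0 ≤ b := fun h => hab (by simp [h, hkj])
          rw [update_comm hkj, update_comm hkj, update_comm hkj, update_comm hkj, update_comm hkj,
            update_comm hkj, hA _ (hupd x hx _ (posPart_nonneg _)) k a b hks,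
            hA _ (hupd x hx _ (negPart_nonneg _)) k a b hks]
          ring
      · rcases eq_or_ne k j with rfl | hkj
        · simp only [update_idem, update_self]
          exact (hone x hx).2.1 c a
        · simp only [update_of_ne hkj.symm]
          have hks : k ∉ s → 0 ≤ c ∧ 0 ≤ a := fun h => hca (by simp [h, hkj])
          rw [update_comm hkj, update_comm hkj, update_comm hkj, update_comm hkj,
            hH _ (hupd x hx _ (posPart_nonneg _)) k c a hks,
            hH _ (hupd x hx _ (negPart_nonneg _)) k c a hks]
          ring
  obtain ⟨S', hS, hA, hH⟩ := key Finset.univ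
  refine ⟨MultilinearMap.mk' S' (fun x k a b => ?_) (fun x k c a => ?_), hS⟩
  · exact hA x (by simp) k a b (by simp)
  · exact hH x (by simp) k c a (by simp)

end Extension

section Polynomials

variable (𝕜 : Type*) [Field 𝕜] (m : ℕ) (V : Type*) [AddCommGroup V] [Module 𝕜 V]

/-- The symmetric `m`-linear forms on `V`. -/
def symmForms : Submodule 𝕜 (MultilinearMap 𝕜 (fun _ : Fin m => V) 𝕜) where
  carrier := {A | ∀ (σ : Equiv.Perm (Fin m)) (v : Fin m → V), A (v ∘ σ) = A v}
  add_mem' hA hB σ v := by simp [hA σ v, hB σ v]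
  zero_mem' _ _ := rfl
  smul_mem' c A hA σ v := by simp [hA σ v]

/-- The space of scalar-valued `m`-homogeneous polynomials on `V`. A polynomial is represented by
the unique symmetric `m`-linear form that generates it; its values are given by `HomPoly.eval`. -/
abbrev HomPoly : Type _ := symmForms 𝕜 m V

variable {𝕜 m V}

/-- The value `P z = A (z, …, z)` of the polynomial generated by `A`. -/
def HomPoly.eval (P : HomPoly 𝕜 m V) (z : V) : 𝕜 := P.1 fun _ => z

end Polynomials

section RealPolynomials

variable {m : ℕ} {E : Type*} [AddCommGroup E] [Lattice E] [IsOrderedAddMonoid E] [Module ℝ E]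
  [IsOrderedModule ℝ E]

/-- The order on real polynomials: `P ≤ Q` when the generating form of `Q - P` is nonnegative on
tuples of positive vectors. -/
instance : Preorder (HomPoly ℝ m E) where
  le P Q := ∀ x : Fin m → E, 0 ≤ x → P.1 x ≤ Q.1 x
  le_refl _ _ _ := le_rfl
  le_trans _ _ _ h₁ h₂ x hx := (h₁ x hx).trans (h₂ x hx)

theorem exists_isLUB_homPoly {N : (Fin m → E) → ℝ} (hh : ConeHomog N) (hs : ∀ k, ConeSub N k)
    (hsymm : ∀ (σ : Equiv.Perm (Fin m)) x, 0 ≤ x → N (x ∘ σ) = N x)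
    (B : HomPoly ℝ m E) (hNB : ∀ x, 0 ≤ x → N x ≤ B.1 x) :
    ∃ Q : HomPoly ℝ m E, (∀ x, 0 ≤ x → N x ≤ Q.1 x) ∧
      ∀ R : HomPoly ℝ m E, (∀ x, 0 ≤ x → N x ≤ R.1 x) → Q ≤ R := by
  have hadd : ∀ R : MultilinearMap ℝ (fun _ : Fin m => E) ℝ, ∀ k, ConeAdd R k :=
    fun R k x _ a b _ _ => R.map_update_add x k a b
  obtain ⟨S, hNS, hSh, hSa, hSl⟩ := exists_least_coneAdd hh hs (hadd B.1) hNB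
  have hcomp : ∀ (σ : Equiv.Perm (Fin m)) (x : Fin m → E), 0 ≤ x → 0 ≤ x ∘ σ :=
    fun σ x hx i => hx (σ i)
  have hle : ∀ (σ : Equiv.Perm (Fin m)) x, 0 ≤ x → S x ≤ S (x ∘ σ) := by
    intro σ
    refine hSl (fun x => S (x ∘ σ)) (fun k x hx a b ha hb => ?_) fun x hx => ?_
    · have e : ∀ u, update x k u ∘ σ = update (x ∘ σ) (σ.symm k) u :=
        fun u => update_comp_equiv x σ k u
      simp only [e]
      exact hSa _ _ (hcomp σ x hx) a b ha hb
    · rw [← hsymm σ x hx]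
      exact hNS _ (hcomp σ x hx)
  have heq : ∀ (σ : Equiv.Perm (Fin m)) x, 0 ≤ x → S (x ∘ σ) = S x := by
    intro σ x hx
    refine le_antisymm ?_ (hle σ x hx)
    have := hle σ⁻¹ (x ∘ σ) (hcomp σ x hx)
    rwa [comp_assoc, show (σ ∘ ⇑σ⁻¹) = id from funext fun i => by simp, comp_id] at this
  obtain ⟨A, hA⟩ := exists_multilinear_extension hSh hSa
  let Q : MultilinearMap ℝ (fun _ : Fin m => E) ℝ :=
    ((Fintype.card (Equiv.Perm (Fin m)) : ℝ)⁻¹) • ∑ σ : Equiv.Perm (Fin m), A.domDomCongr σ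
  have hQapp : ∀ x, Q x = (Fintype.card (Equiv.Perm (Fin m)) : ℝ)⁻¹ *
      ∑ σ : Equiv.Perm (Fin m), A (x ∘ σ) := by
    intro x
    simp only [Q, smul_apply, sum_apply,
      MultilinearMap.domDomCongr_apply, smul_eq_mul]
    rfl
  have hQS : ∀ x, 0 ≤ x → Q x = S x := by
    intro x hx
    rw [hQapp, Finset.sum_congr rfl fun σ _ => (hA _ (hcomp σ x hx)).trans (heq σ x hx),
      Finset.sum_const, Finset.card_univ, nsmul_eq_mul, inv_mul_cancel_left₀]
    exact_mod_cast Fintype.card_ne_zero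
  refine ⟨⟨Q, fun σ v => ?_⟩, fun x hx => ?_, fun R hR x hx => ?_⟩
  · rw [hQapp, hQapp]
    congr 1
    exact Fintype.sum_equiv (Equiv.mulLeft σ) _ _ fun ρ => by
      simp [Equiv.Perm.coe_mul, comp_assoc]
  · exact (hNS x hx).trans (hQS x hx).ge
  · exact (hQS x hx).le.trans (hSl R.1 (hadd R.1) hR x hx)

/-- A real polynomial is regular if it is a difference of two positive polynomials. -/
def IsRegularReal (R : HomPoly ℝ m E) : Prop :=
  ∃ P₁ P₂ : HomPoly ℝ m E, 0 ≤ P₁ ∧ 0 ≤ P₂ ∧ R = P₁ - P₂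

end RealPolynomials

/-- The complexification `E + iE` of a real vector space. -/
@[ext]
structure Complexification (E : Type*) where
  re : E
  im : E

namespace Complexification

section VectorSpace

variable {E : Type*} [AddCommGroup E] [Module ℝ E]

/-- The underlying bijection with `E × E`. -/
def equivProd (E : Type*) : Complexification E ≃ E × E where
  toFun z := (z.re, z.im)
  invFun p := ⟨p.1, p.2⟩

instance : AddCommGroup (Complexification E) := (equivProd E).addCommGroup

instance : SMul ℂ (Complexification E) :=
  ⟨fun c z => ⟨c.re • z.re - c.im • z.im, c.re • z.im + c.im • z.re⟩⟩

theorem re_add (z w : Complexification E) : (z + w).re = z.re + w.re := rfl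

theorem im_add (z w : Complexification E) : (z + w).im = z.im + w.im := rfl

theorem re_smul (c : ℂ) (z : Complexification E) :
    (c • z).re = c.re • z.re - c.im • z.im := rfl

theorem im_smul (c : ℂ) (z : Complexification E) :
    (c • z).im = c.re • z.im + c.im • z.re := rfl

theorem re_zero : (0 : Complexification E).re = 0 := rfl

theorem im_zero : (0 : Complexification E).im = 0 := rfl

instance : Module ℂ (Complexification E) where
  one_smul z := by ext <;> simp [re_smul, im_smul]
  mul_smul c d z := by
    ext <;> simp only [re_smul, im_smul, Complex.mul_re, Complex.mul_im] <;> module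
  smul_zero c := by ext <;> simp [re_smul, im_smul, re_zero, im_zero]
  smul_add c z w := by
    ext <;> simp only [re_smul, im_smul, re_add, im_add] <;> module
  add_smul c d z := by
    ext <;> simp only [re_smul, im_smul, re_add, im_add, Complex.add_re, Complex.add_im] <;> module
  zero_smul z := by ext <;> simp [re_smul, im_smul, re_zero, im_zero]

variable (E) in
/-- The inclusion of the real part `E` into its complexification. -/
def ofReal : E →ₗ[ℝ] Complexification E where
  toFun x := ⟨x, 0⟩
  map_add' x y := by ext <;> simp [re_add, im_add]
  map_smul' c x := by
    rw [RingHom.id_apply, ← Complex.coe_smul c (⟨x, 0⟩ : Complexification E)]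
    ext <;> simp only [re_smul, im_smul] <;> simp

end VectorSpace

section Modulus

variable {E : Type*} [NormedAddCommGroup E] [Lattice E] [IsOrderedAddMonoid E] [HasSolidNorm E]
  [NormedSpace ℝ E] [IsOrderedModule ℝ E] [CompleteSpace E]

/-- The function `(s, t) ↦ √(s² + t²)`. -/
def hypot : PosHom 2 :=
  ⟨⟨fun t => √(t 0 ^ 2 + t 1 ^ 2), by fun_prop⟩, fun c hc t => by
    simp only [ContinuousMap.coe_mk, Pi.smul_apply, smul_eq_mul, mul_pow, ← mul_add]
    rw [Real.sqrt_mul (sq_nonneg c), Real.sqrt_sq hc]⟩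

/-- The modulus `|x + iy| = √(x² + y²)` in the sense of the Krivine functional calculus. -/
def modulus (z : Complexification E) : E := krivine ![z.re, z.im] hypot

/-- The norm `‖z‖ = ‖|z|‖` of a complex Banach lattice. -/
instance : Norm (Complexification E) := ⟨fun z => ‖modulus z‖⟩

/-- The modulus is also `sup {x cos φ + y sin φ : 0 ≤ φ ≤ 2π}`. -/
theorem isLUB_modulus (z : Complexification E) :
    IsLUB ((fun φ : ℝ => Real.cos φ • z.re + Real.sin φ • z.im) '' Set.Icc 0 (2 * Real.pi))
      (modulus z) := by
  have hval : Val ![z.re, z.im] hypot.1 (modulus z) :=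
    (isKrivineCalculus_krivine ![z.re, z.im]).val hypot
  have hbound : ∀ φ s t : ℝ, Real.cos φ * s + Real.sin φ * t ≤ √(s ^ 2 + t ^ 2) := by
    intro φ s t
    apply Real.le_sqrt_of_sq_le
    nlinarith [sq_nonneg (Real.sin φ * s - Real.cos φ * t), Real.sin_sq_add_cos_sq φ]
  constructor
  · rintro _ ⟨φ, _, rfl⟩
    have h := (PLValue.linear ![z.re, z.im] ![Real.cos φ, Real.sin φ]).val
    simp only [Fin.sum_univ_two, Matrix.cons_val_zero, Matrix.cons_val_one] at h
    exact h.mono hval fun t => hbound φ (t 0) (t 1)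
  · intro u hu
    refine le_of_forall_pos_smul (q := maxLin (signs 2) (signs_nonempty 2) ![z.re, z.im])
      fun ε hε => ?_
    obtain ⟨F, hFs, hFf, hFc⟩ := (isCompact_Icc (a := (0 : ℝ)) (b := 2 * Real.pi)).finite_cover_balls
      hε
    have hne : F.Nonempty := by
      have h0 : (0 : ℝ) ∈ Set.Icc 0 (2 * Real.pi) := ⟨le_rfl, by positivity⟩
      obtain ⟨ψ, hψ, _⟩ := Set.mem_iUnion₂.1 (hFc h0)
      exact ⟨ψ, hψ⟩
    let a : Finset (Fin 2 → ℝ) := hFf.toFinset.image fun ψ => ![Real.cos ψ, Real.sin ψ]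
    have ha : a.Nonempty := Finset.Nonempty.image ((Set.Finite.toFinset_nonempty hFf).2 hne) _
    have hpl : PLValue ![z.re, z.im] (maxLin a ha) (maxLin a ha ![z.re, z.im]) :=
      ⟨a, ha, {0}, by simp, fun t => by simp [maxLin], by simp [maxLin]⟩
    have hau : maxLin a ha ![z.re, z.im] ≤ u := by
      refine Finset.sup'_le _ _ fun α hα => ?_
      obtain ⟨ψ, hψ, rfl⟩ := Finset.mem_image.1 hα
      simpa [Fin.sum_univ_two] using hu ⟨ψ, hFs (hFf.mem_toFinset.1 hψ), rfl⟩
    refine (hval.mono (hpl.add ((plValue_signs _).smul ε)).val fun t => ?_).trans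
      (add_le_add hau le_rfl)
    have hpolar : ∃ φ ∈ Set.Icc 0 (2 * Real.pi),
        √(t 0 ^ 2 + t 1 ^ 2) ≤ Real.cos φ * t 0 + Real.sin φ * t 1 := by
      let ζ : ℂ := ⟨t 0, t 1⟩
      have hn : ‖ζ‖ = √(t 0 ^ 2 + t 1 ^ 2) := Complex.norm_eq_sqrt_sq_add_sq ζ
      have h1 : ‖ζ‖ * Real.cos ζ.arg = t 0 := Complex.norm_mul_cos_arg ζ
      have h2 : ‖ζ‖ * Real.sin ζ.arg = t 1 := Complex.norm_mul_sin_arg ζ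
      have h3 : √(t 0 ^ 2 + t 1 ^ 2) ≤ Real.cos ζ.arg * t 0 + Real.sin ζ.arg * t 1 := by
        refine le_of_eq ?_
        rw [← hn, ← h1, ← h2]
        linear_combination (-‖ζ‖) * Real.sin_sq_add_cos_sq ζ.arg
      rcases le_total 0 ζ.arg with h | h
      · exact ⟨ζ.arg, ⟨h, by linarith [Complex.arg_le_pi ζ, Real.pi_pos]⟩, h3⟩
      · refine ⟨ζ.arg + 2 * Real.pi, ⟨by linarith [Complex.neg_pi_lt_arg ζ, Real.pi_pos], by
          linarith⟩, ?_⟩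
        rwa [Real.cos_add_two_pi, Real.sin_add_two_pi]
    obtain ⟨φ, hφ, hle⟩ := hpolar
    obtain ⟨ψ, hψ, hd⟩ := Set.mem_iUnion₂.1 (hFc hφ)
    have hd' : |φ - ψ| ≤ ε := (Metric.mem_ball.1 hd).le
    have hmem : ![Real.cos ψ, Real.sin ψ] ∈ a :=
      Finset.mem_image.2 ⟨ψ, hFf.mem_toFinset.2 hψ, rfl⟩
    have h4 : Real.cos ψ * t 0 + Real.sin ψ * t 1 ≤ maxLin a ha t := by
      have := Finset.le_sup' (fun α : Fin 2 → ℝ => ∑ i, α i • t i) hmem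
      simp only [Fin.sum_univ_two, Matrix.cons_val_zero, Matrix.cons_val_one, smul_eq_mul] at this
      simpa only [maxLin, Fin.sum_univ_two, smul_eq_mul] using this
    have h5 := sum_abs_le_maxLin_signs t
    rw [Fin.sum_univ_two] at h5
    have h6 : (Real.cos φ - Real.cos ψ) * t 0 ≤ ε * |t 0| := by
      refine (le_abs_self _).trans ?_
      rw [abs_mul]
      exact mul_le_mul_of_nonneg_right ((Real.abs_cos_sub_cos_le φ ψ).trans hd') (abs_nonneg _)
    have h7 : (Real.sin φ - Real.sin ψ) * t 1 ≤ ε * |t 1| := by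
      refine (le_abs_self _).trans ?_
      rw [abs_mul]
      exact mul_le_mul_of_nonneg_right ((Real.abs_sin_sub_sin_le φ ψ).trans hd') (abs_nonneg _)
    have h8 := mul_le_mul_of_nonneg_left h5 hε.le
    show √(t 0 ^ 2 + t 1 ^ 2) ≤ _
    nlinarith

/-- The function `(s, t) ↦ |s|^θ |t|^(1-θ)`, for `0 < θ < 1`. -/
def geom (θ : Set.Ioo (0 : ℝ) 1) : PosHom 2 :=
  ⟨⟨fun t => |t 0| ^ (θ : ℝ) * |t 1| ^ (1 - θ : ℝ),
    (Continuous.rpow_const (by fun_prop) fun _ => Or.inr θ.2.1.le).mul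
      (Continuous.rpow_const (by fun_prop) fun _ => Or.inr (sub_nonneg.2 θ.2.2.le))⟩,
    fun c hc t => by
      simp only [ContinuousMap.coe_mk, Pi.smul_apply, smul_eq_mul, abs_mul, abs_of_nonneg hc]
      rw [Real.mul_rpow hc (abs_nonneg _), Real.mul_rpow hc (abs_nonneg _)]
      have : c ^ (θ : ℝ) * c ^ (1 - θ : ℝ) = c := by
        rw [← Real.rpow_add' hc (by simp), add_sub_cancel, Real.rpow_one]
      linear_combination (|t 0| ^ (θ : ℝ) * |t 1| ^ (1 - θ : ℝ)) * this⟩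

/-- The element `|z|^θ |w|^(1-θ)` in the sense of the Krivine functional calculus. -/
def geomMean (θ : Set.Ioo (0 : ℝ) 1) (z w : Complexification E) : E :=
  krivine ![modulus z, modulus w] (geom θ)

/-- A set is solid if it contains, with `z`, every `w` such that `|w| ≤ |z|`. -/
def IsSolid (D : Set (Complexification E)) : Prop :=
  ∀ z ∈ D, ∀ w, modulus w ≤ modulus z → w ∈ D

/-- A set is logarithmically convex if it contains, with `z` and `w`, all `|z|^θ |w|^(1-θ)`. -/
def IsLogConvex (D : Set (Complexification E)) : Prop :=
  ∀ z ∈ D, ∀ w ∈ D, ∀ θ : Set.Ioo (0 : ℝ) 1, ofReal E (geomMean θ z w) ∈ D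

end Modulus

end Complexification

section ComplexPolynomials

open Complexification

variable {m : ℕ} {E : Type*}

section Parts

variable [AddCommGroup E] [Module ℝ E]

/-- The real part of a complex polynomial `P`, determined by `x ↦ Re P(x)` for real `x`. -/
def HomPoly.rePart (P : HomPoly ℂ m (Complexification E)) : HomPoly ℝ m E :=
  ⟨Complex.reLm.compMultilinearMap
      ((P.1.restrictScalars ℝ).compLinearMap fun _ => ofReal E),
    fun σ v => congrArg Complex.re (P.2 σ fun i => ofReal E (v i))⟩

/-- The imaginary part of a complex polynomial `P`, determined by `x ↦ Im P(x)` for real `x`. -/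
def HomPoly.imPart (P : HomPoly ℂ m (Complexification E)) : HomPoly ℝ m E :=
  ⟨Complex.imLm.compMultilinearMap
      ((P.1.restrictScalars ℝ).compLinearMap fun _ => ofReal E),
    fun σ v => congrArg Complex.im (P.2 σ fun i => ofReal E (v i))⟩

end Parts

variable [AddCommGroup E] [Lattice E] [IsOrderedAddMonoid E] [Module ℝ E] [IsOrderedModule ℝ E]

/-- A complex polynomial is regular if its real and imaginary parts are. -/
def IsRegular (P : HomPoly ℂ m (Complexification E)) : Prop :=
  IsRegularReal P.rePart ∧ IsRegularReal P.imPart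

/-- `Q` is the absolute value of `P = P₀ + i P₁`: it is a regular polynomial and the supremum of the
polynomials `P₀ cos φ + P₁ sin φ`. (An upper bound of regular polynomials is regular, so it does
not matter whether the supremum is taken among all or among the regular polynomials.) -/
def IsPolyAbs (P : HomPoly ℂ m (Complexification E)) (Q : HomPoly ℝ m E) : Prop :=
  IsRegularReal Q ∧
    IsLUB ((fun φ : ℝ => Real.cos φ • P.rePart + Real.sin φ • P.imPart) ''
      Set.Icc 0 (2 * Real.pi)) Q

theorem exists_isPolyAbs {P : HomPoly ℂ m (Complexification E)} (hP : IsRegular P) :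
    ∃ Q, IsPolyAbs P Q := by
  obtain ⟨⟨P₁, P₂, h₁, h₂, hre⟩, P₃, P₄, h₃, h₄, him⟩ := hP
  let A : MultilinearMap ℝ (fun _ : Fin m => E) ℂ :=
    (P.1.restrictScalars ℝ).compLinearMap fun _ => ofReal E
  have hAre : ∀ x, (A x).re = P.rePart.1 x := fun _ => rfl
  have hAim : ∀ x, (A x).im = P.imPart.1 x := fun _ => rfl
  obtain ⟨Q, hQ, hQl⟩ := exists_isLUB_homPoly (N := fun x => ‖A x‖)
    (fun x _ k c hc a _ => by
      beta_reduce
      rw [A.map_update_smul, norm_smul, Real.norm_of_nonneg hc])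
    (fun k x _ a b _ _ => by
      beta_reduce
      rw [A.map_update_add]
      exact norm_add_le _ _)
    (fun σ x _ => congrArg norm (P.2 σ fun i => ofReal E (x i)))
    (P₁ + P₂ + (P₃ + P₄)) (fun x hx => by
      refine (Complex.norm_le_abs_re_add_abs_im (A x)).trans ?_
      have e₁ : 0 ≤ P₁.1 x := h₁ x hx
      have e₂ : 0 ≤ P₂.1 x := h₂ x hx
      have e₃ : 0 ≤ P₃.1 x := h₃ x hx
      have e₄ : 0 ≤ P₄.1 x := h₄ x hx
      have er : (A x).re = P₁.1 x - P₂.1 x := by rw [hAre, hre]; rfl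
      have ei : (A x).im = P₃.1 x - P₄.1 x := by rw [hAim, him]; rfl
      have : (P₁ + P₂ + (P₃ + P₄)).1 x = P₁.1 x + P₂.1 x + (P₃.1 x + P₄.1 x) := rfl
      rw [er, ei, this]
      exact add_le_add (abs_le.2 ⟨by linarith, by linarith⟩)
        (abs_le.2 ⟨by linarith, by linarith⟩))
  have hcomb : ∀ (φ : ℝ) x, (Real.cos φ • P.rePart + Real.sin φ • P.imPart).1 x =
      Real.cos φ * (A x).re + Real.sin φ * (A x).im := fun _ _ => rfl
  refine ⟨Q, ⟨Q, 0, fun x hx => (norm_nonneg _).trans (hQ x hx), le_rfl, (sub_zero Q).symm⟩,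
    ?_, fun R hR => hQl R fun x hx => ?_⟩
  · rintro _ ⟨φ, _, rfl⟩ x hx
    refine le_trans ?_ (hQ x hx)
    rw [hcomb, Complex.norm_eq_sqrt_sq_add_sq]
    apply Real.le_sqrt_of_sq_le
    nlinarith [sq_nonneg (Real.sin φ * (A x).re - Real.cos φ * (A x).im),
      Real.sin_sq_add_cos_sq φ]
  · have hR' : ∀ φ ∈ Set.Icc 0 (2 * Real.pi),
        Real.cos φ * (A x).re + Real.sin φ * (A x).im ≤ R.1 x := fun φ hφ => by
      rw [← hcomb]
      exact hR ⟨φ, hφ, rfl⟩ x hx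
    have h3 : ‖A x‖ = Real.cos (A x).arg * (A x).re + Real.sin (A x).arg * (A x).im := by
      have e1 := Complex.norm_mul_cos_arg (A x)
      have e2 := Complex.norm_mul_sin_arg (A x)
      rw [← e1, ← e2]
      linear_combination (-‖A x‖) * Real.sin_sq_add_cos_sq (A x).arg
    show ‖A x‖ ≤ _
    rw [h3]
    rcases le_total 0 (A x).arg with h | h
    · exact hR' _ ⟨h, by linarith [Complex.arg_le_pi (A x), Real.pi_pos]⟩
    · have := hR' ((A x).arg + 2 * Real.pi)
        ⟨by linarith [Complex.neg_pi_lt_arg (A x), Real.pi_pos], by linarith⟩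
      rwa [Real.cos_add_two_pi, Real.sin_add_two_pi] at this

/-- The absolute value `|P|` of a regular polynomial, a positive polynomial on the real part. -/
def polyAbs (P : HomPoly ℂ m (Complexification E)) (hP : IsRegular P) : HomPoly ℝ m E :=
  (exists_isPolyAbs hP).choose

theorem isPolyAbs_polyAbs (P : HomPoly ℂ m (Complexification E)) (hP : IsRegular P) :
    IsPolyAbs P (polyAbs P hP) :=
  (exists_isPolyAbs hP).choose_spec

end ComplexPolynomials

section PowerSeries

open Complexification

variable {E : Type*} [NormedAddCommGroup E] [Lattice E] [IsOrderedAddMonoid E] [HasSolidNorm E]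
  [NormedSpace ℝ E] [IsOrderedModule ℝ E] [CompleteSpace E]

/-- The set of points `z` at which the power series `∑ P m` with regular terms converges
regularly, that is, `∑ |P m|(|z|)` converges (a series of nonnegative real numbers). -/
def regularConvergenceSet (P : ∀ m : ℕ, HomPoly ℂ m (Complexification E))
    (hP : ∀ m, IsRegular (P m)) : Set (Complexification E) :=
  {z | Summable fun m => (polyAbs (P m) (hP m)).eval (modulus z)}

end PowerSeries

end

end ComplexBanachLattice

open ComplexBanachLattice ComplexBanachLattice.Complexification

/-! Everything rests on the Hölder-type inequality for a positive polynomial `Q` at positive vectors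
`x = |z|` and `y = |w|`; the two claims about the convergence set follow termwise from it and from
monotonicity.

If `x = ∑ a j • e j` and `y = ∑ b j • e j` with nonnegative coefficients and positive `e j`, the
inequality is elementary. By multilinearity `Q` is a polynomial in the coefficients, whose own
coefficients are values of the generating form at tuples of the `e j` and hence nonnegative.
Hölder's inequality with exponents `1/θ` and `1/(1-θ)` for that finite sum gives the bound
(`HomPoly.eval_sum_rpow_le`).

General `x` and `y` are almost of this form. With `q = |s| + |t|`, the function `q` on the plane is
cut into pieces `hat N j`, `0 ≤ j ≤ N`, where `|s|/q` lies within `1/N` of `j/N`. On such a piece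
`|s| ≤ a j * q` and `|t| ≤ b j * q` with `a j = (j+1)/N` and `b j = (N-j+1)/N`, and both bounds are
off by at most `2q/N`. Hence `|s|^θ |t|^(1-θ)` is at most `∑ a j^θ b j^(1-θ) hat N j`, while `∑ a j
hat N j` and `∑ b j hat N j` exceed `|s|` and `|t|` by at most `2q/N`. The Krivine calculus carries
these inequalities to `E`, with positive vectors `e j`, and positive polynomials are monotone on the
positive cone (`HomPoly.eval_mono`). So the inequality holds with `x` and `y` replaced by `x + (2/N)
• (x+y)` and `y + (2/N) • (x+y)`. Letting `N → ∞` needs continuity of `Q` along lines only, where it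
is a polynomial in one variable (`HomPoly.eval_krivine_geom_le`).

The absolute values `|P m|` are positive polynomials (`polyAbs_nonneg`). Solidity is then the
comparison test, and logarithmic convexity is the comparison test after weighted AM-GM. -/

namespace ComplexBanachLattice

/-! ### Positive polynomials on the positive cone -/

section PositivePolynomials

variable {m : ℕ} {E : Type*} [AddCommGroup E] [Module ℝ E]

/-- Multilinear expansion: on the span of finitely many vectors a homogeneous polynomial is an
ordinary polynomial in the coordinates. For positive `Q` and positive `e j` its coefficients are
nonnegative, which is what Hölder's inequality needs. -/
theorem HomPoly.eval_sum_smul {ι : Type*} [Fintype ι] (Q : HomPoly ℝ m E) (c : ι → ℝ) (e : ι → E) :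
    Q.eval (∑ j, c j • e j) = ∑ r : Fin m → ι, (∏ i, c (r i)) * Q.1 fun i => e (r i) := by
  classical
  rw [HomPoly.eval, MultilinearMap.map_sum Q.1 fun _ j => c j • e j]
  exact Finset.sum_congr rfl fun r _ => Q.1.map_smul_univ (fun i => c (r i)) fun i => e (r i)

/-- The restriction to a line is a polynomial in `δ`, so no topology on `E` is involved. This is the
only continuity the final limit uses. -/
theorem HomPoly.continuous_eval_add_smul (Q : HomPoly ℝ m E) (x y : E) :
    Continuous fun δ : ℝ => Q.eval (x + δ • y) := by
  have h : ∀ δ : ℝ, Q.eval (x + δ • y) =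
      ∑ r : Fin m → Fin 2, (∏ i, ![1, δ] (r i)) * Q.1 fun i => ![x, y] (r i) := fun δ => by
    rw [← HomPoly.eval_sum_smul]
    simp [Fin.sum_univ_two]
  simp only [h]
  refine continuous_finsetSum _ fun r _ => .mul (continuous_finsetProd _ fun i _ => ?_)
    continuous_const
  have : Continuous fun δ : ℝ => (![1, δ] : Fin 2 → ℝ) := by fun_prop
  exact (continuous_apply (r i)).comp this

variable [Lattice E]

theorem HomPoly.eval_nonneg {Q : HomPoly ℝ m E} (hQ : 0 ≤ Q) {x : E} (hx : 0 ≤ x) :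
    0 ≤ Q.eval x :=
  hQ (fun _ => x) fun _ => hx

/-- Hölder's inequality for a positive polynomial on the cone spanned by finitely many positive
vectors. -/
theorem HomPoly.eval_sum_rpow_le {ι : Type*} [Fintype ι] {Q : HomPoly ℝ m E} (hQ : 0 ≤ Q)
    {θ : ℝ} (hθ₀ : 0 < θ) (hθ₁ : θ < 1) {a b : ι → ℝ} (ha : ∀ j, 0 ≤ a j) (hb : ∀ j, 0 ≤ b j)
    {e : ι → E} (he : ∀ j, 0 ≤ e j) :
    Q.eval (∑ j, (a j ^ θ * b j ^ (1 - θ)) • e j) ≤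
      Q.eval (∑ j, a j • e j) ^ θ * Q.eval (∑ j, b j • e j) ^ (1 - θ) := by
  have hθ₂ : 0 < 1 - θ := sub_pos.2 hθ₁
  have hA : ∀ r : Fin m → ι, 0 ≤ Q.1 fun i => e (r i) := fun r => hQ _ fun i => he (r i)
  have hpa : ∀ r : Fin m → ι, 0 ≤ ∏ i, a (r i) := fun r => Finset.prod_nonneg fun i _ => ha _
  have hpb : ∀ r : Fin m → ι, 0 ≤ ∏ i, b (r i) := fun r => Finset.prod_nonneg fun i _ => hb _
  rw [HomPoly.eval_sum_smul, HomPoly.eval_sum_smul, HomPoly.eval_sum_smul]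
  -- The nonnegative value of the form at `e ∘ r` acts as a weight, shared between the two factors
  -- as its powers `θ` and `1 - θ`. The conjugate exponents `θ⁻¹` and `(1 - θ)⁻¹` then undo the
  -- outer powers and leave the two expansions.
  have h := Real.inner_le_Lp_mul_Lq_of_nonneg (Finset.univ : Finset (Fin m → ι))
    (f := fun r => ((∏ i, a (r i)) * Q.1 fun i => e (r i)) ^ θ)
    (g := fun r => ((∏ i, b (r i)) * Q.1 fun i => e (r i)) ^ (1 - θ))
    (Real.HolderConjugate.inv_one_sub_inv hθ₀ hθ₁)
    (fun r _ => Real.rpow_nonneg (mul_nonneg (hpa r) (hA r)) _)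
    (fun r _ => Real.rpow_nonneg (mul_nonneg (hpb r) (hA r)) _)
  simp only [one_div, inv_inv] at h
  rw [Finset.sum_congr rfl fun r _ => Real.rpow_rpow_inv (mul_nonneg (hpa r) (hA r)) hθ₀.ne',
    Finset.sum_congr rfl fun r _ => Real.rpow_rpow_inv (mul_nonneg (hpb r) (hA r)) hθ₂.ne'] at h
  refine le_trans (Finset.sum_le_sum fun r _ => le_of_eq ?_) h
  -- Recombining the weight by `Real.rpow_add'` is legitimate even where it vanishes, since the
  -- exponents add up to `1 ≠ 0`.
  rw [Finset.prod_mul_distrib, Real.finsetProd_rpow _ _ fun i _ => ha _,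
    Real.finsetProd_rpow _ _ fun i _ => hb _, Real.mul_rpow (hpa r) (hA r),
    Real.mul_rpow (hpb r) (hA r), mul_mul_mul_comm, ← Real.rpow_add' (hA r) (by simp),
    add_sub_cancel, Real.rpow_one]

variable [IsOrderedAddMonoid E]

/-- Expanding `Q` at `y = x + (y - x)` gives a sum over subsets of the `m` slots. Every term is a
value of the form at positive vectors, and the full subset contributes `Q.eval x`. -/
theorem HomPoly.eval_mono {Q : HomPoly ℝ m E} (hQ : 0 ≤ Q) {x y : E} (hx : 0 ≤ x) (hxy : x ≤ y) :
    Q.eval x ≤ Q.eval y := by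
  have h := Q.1.map_add_univ (fun _ => x) fun _ => y - x
  rw [show ((fun _ => x) + fun _ => y - x : Fin m → E) = fun _ => y from
    funext fun _ => add_sub_cancel x y] at h
  rw [HomPoly.eval, HomPoly.eval, h]
  have hle := Finset.single_le_sum (f := fun s : Finset (Fin m) =>
    Q.1 (s.piecewise (fun _ => x) fun _ => y - x)) (s := Finset.univ)
    (fun s _ => hQ _ fun i => by
      by_cases hi : i ∈ s
      · simpa [hi] using hx
      · simpa [hi] using hxy) (Finset.mem_univ Finset.univ)
  simpa using hle

variable [IsOrderedModule ℝ E]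

/-- The angles `0` and `π` show that `|P|` dominates both the real part of `P` and its negative;
adding the two bounds gives `0 ≤ 2|P|`. -/
theorem polyAbs_nonneg (P : HomPoly ℂ m (Complexification E)) (hP : IsRegular P) :
    0 ≤ polyAbs P hP := by
  intro x hx
  have h₁ : P.rePart.1 x ≤ (polyAbs P hP).1 x := by
    have := (isPolyAbs_polyAbs P hP).2.1 ⟨0, ⟨le_rfl, by positivity⟩, rfl⟩ x hx
    simpa using this
  have h₂ : -P.rePart.1 x ≤ (polyAbs P hP).1 x := by
    have := (isPolyAbs_polyAbs P hP).2.1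
      ⟨Real.pi, ⟨Real.pi_pos.le, by linarith [Real.pi_pos]⟩, rfl⟩ x hx
    simpa using this
  show (0 : ℝ) ≤ _
  linarith

end PositivePolynomials

/-! ### Hat functions and the discretised geometric mean -/

section Hat

/-- The hat functions centred at the multiples of `q` sum to `q` on `[0, N q]`. -/
theorem sum_hat {q r : ℝ} (hq : 0 ≤ q) (hr : 0 ≤ r) {N : ℕ} (hrN : r ≤ N * q) :
    ∑ j : Fin (N + 1), max 0 (q - |r - (j : ℕ) * q|) = q := by
  -- A hat is the difference of two shifted ramps, each clamped to `[0, q]`. Neighbouring hats share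
  -- a ramp, so the sum telescopes.
  have hclamp : ∀ s : ℝ, max 0 (q - |s|) = max 0 (min (s + q) q) - max 0 (min s q) := by
    intro s
    rcases le_total 0 s with hs | hs
    · rw [abs_of_nonneg hs, min_eq_right (by linarith), max_eq_right hq]
      rcases le_total s q with h | h
      · rw [min_eq_left h, max_eq_right hs, max_eq_right (by linarith)]
      · rw [min_eq_right h, max_eq_right hq, max_eq_left (by linarith), sub_self]
    · rw [abs_of_nonpos hs, min_eq_left (by linarith), min_eq_left (hs.trans hq),
        max_eq_left hs, sub_zero, sub_neg_eq_add, add_comm]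
  rw [Fin.sum_univ_eq_sum_range (fun j : ℕ => max 0 (q - |r - j * q|))]
  have h : ∀ j : ℕ, max 0 (q - |r - j * q|) =
      max 0 (min (r - j * q + q) q) - max 0 (min (r - (j + 1 : ℕ) * q + q) q) := fun j => by
    rw [hclamp]
    congr 4
    push_cast
    ring
  rw [Finset.sum_congr rfl fun j _ => h j,
    Finset.sum_range_sub' (fun j : ℕ => max 0 (min (r - j * q + q) q))]
  -- The two surviving ramps: the one at `r + q` is saturated at `q` because `r ≥ 0`, and the one at
  -- `r - N q` is zero because `r ≤ N q`.
  rw [min_eq_right (by push_cast; linarith), max_eq_right hq, min_eq_left (by push_cast; linarith),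
    max_eq_left (by push_cast; linarith), sub_zero]

/-- The functions `q max(0, 1 - |N |s| / q - j|)` with `q = |s| + |t|`, a partition of `q` into
pieces on which the ratio of `|s|` and `|t|` is almost constant. -/
noncomputable def hat (N j : ℕ) : PosHom 2 :=
  ⟨⟨fun t => max 0 (|t 0| + |t 1| - |N * |t 0| - j * (|t 0| + |t 1|)|), by fun_prop⟩,
    fun c hc t => by
      simp only [ContinuousMap.coe_mk, Pi.smul_apply, smul_eq_mul, abs_mul, abs_of_nonneg hc]
      rw [show N * (c * |t 0|) - j * (c * |t 0| + c * |t 1|) =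
          c * (N * |t 0| - j * (|t 0| + |t 1|)) by ring, abs_mul, abs_of_nonneg hc,
        mul_max_of_nonneg _ _ hc, mul_zero, mul_sub c, mul_add c]⟩

theorem hat_apply (N j : ℕ) (t : Fin 2 → ℝ) : (hat N j).1 t =
    max 0 (|t 0| + |t 1| - |N * |t 0| - j * (|t 0| + |t 1|)|) := rfl

theorem hat_nonneg (N j : ℕ) (t : Fin 2 → ℝ) : 0 ≤ (hat N j).1 t := le_max_left _ _

theorem sum_hat_apply (N : ℕ) (t : Fin 2 → ℝ) :
    ∑ j : Fin (N + 1), (hat N j).1 t = |t 0| + |t 1| := by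
  refine sum_hat (by positivity) (by positivity) ?_
  exact mul_le_mul_of_nonneg_left (le_add_of_nonneg_right (abs_nonneg _)) N.cast_nonneg

/-- On its support, `hat N j` sees only points where `|s|/q` is within `1/N` of `j/N`, here written
without division. -/
theorem abs_le_of_hat_pos {N j : ℕ} {t : Fin 2 → ℝ} (h : 0 < (hat N j).1 t) :
    |N * |t 0| - j * (|t 0| + |t 1|)| ≤ |t 0| + |t 1| := by
  rw [hat_apply, lt_max_iff] at h
  rcases h with h | h <;> linarith

/-- A bound on the supports of the hat functions gives a bound on a combination of them. -/
theorem sum_mul_hat_le {N : ℕ} {c : Fin (N + 1) → ℝ} {t : Fin 2 → ℝ} {B : ℝ} (hB : 0 ≤ B)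
    (h : ∀ j : Fin (N + 1), 0 < (hat N j).1 t → c j * (|t 0| + |t 1|) ≤ B) :
    ∑ j, c j * (hat N j).1 t ≤ B := by
  have hs := sum_hat_apply N t
  rcases (show 0 ≤ |t 0| + |t 1| by positivity).eq_or_lt with hq | hq
  -- When `q = 0` the nonnegative hats sum to zero, so each of them vanishes.
  · have hz : ∀ j : Fin (N + 1), (hat N j).1 t = 0 := fun j =>
      (Finset.sum_eq_zero_iff_of_nonneg fun j _ => hat_nonneg N _ t).1 (hs.trans hq.symm) j
        (Finset.mem_univ j)
    simpa [hz] using hB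
  -- Both sides are multiplied by `q > 0`, which on the right is again the sum of the hats; it then
  -- suffices to compare term by term, and terms with a vanishing hat are trivial.
  · refine le_of_mul_le_mul_right ?_ hq
    rw [Finset.sum_mul]
    calc ∑ j, c j * (hat N j).1 t * (|t 0| + |t 1|) ≤ ∑ j : Fin (N + 1), B * (hat N j).1 t := by
          refine Finset.sum_le_sum fun j _ => ?_
          rcases (hat_nonneg N j t).eq_or_lt with h0 | h0
          · rw [← h0]; simp
          · rw [mul_right_comm]
            exact mul_le_mul_of_nonneg_right (h j h0) h0.le
      _ = B * (|t 0| + |t 1|) := by rw [← Finset.mul_sum, hs]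

/-- The reverse bound, by the same termwise comparison. At `q = 0` the right side is only known to
be nonnegative here, so `B` has to vanish there. -/
theorem le_sum_mul_hat {N : ℕ} {c : Fin (N + 1) → ℝ} {t : Fin 2 → ℝ} {B : ℝ}
    (hc : ∀ j, 0 ≤ c j) (hB : |t 0| + |t 1| = 0 → B = 0)
    (h : ∀ j : Fin (N + 1), 0 < (hat N j).1 t → B ≤ c j * (|t 0| + |t 1|)) :
    B ≤ ∑ j, c j * (hat N j).1 t := by
  have hs := sum_hat_apply N t
  rcases (show 0 ≤ |t 0| + |t 1| by positivity).eq_or_lt with hq | hq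
  · rw [hB hq.symm]
    exact Finset.sum_nonneg fun j _ => mul_nonneg (hc j) (hat_nonneg N j t)
  · refine le_of_mul_le_mul_right ?_ hq
    rw [Finset.sum_mul]
    calc B * (|t 0| + |t 1|) = ∑ j : Fin (N + 1), B * (hat N j).1 t := by
          rw [← Finset.mul_sum, hs]
      _ ≤ ∑ j, c j * (hat N j).1 t * (|t 0| + |t 1|) := by
          refine Finset.sum_le_sum fun j _ => ?_
          rcases (hat_nonneg N j t).eq_or_lt with h0 | h0
          · rw [← h0]; simp
          · rw [mul_right_comm]
            exact mul_le_mul_of_nonneg_right (h j h0) h0.le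

theorem sum_fst_mul_hat_le {N : ℕ} (hN : 0 < N) (t : Fin 2 → ℝ) :
    ∑ j : Fin (N + 1), (((j : ℕ) + 1) / N : ℝ) * (hat N j).1 t ≤
      |t 0| + 2 / N * (|t 0| + |t 1|) := by
  have hN' : (0 : ℝ) < N := Nat.cast_pos.2 hN
  refine sum_mul_hat_le (by positivity) fun j hj => ?_
  -- The support condition gives `j q ≤ N|s| + q`. One more `q` comes from rounding up to `j + 1`,
  -- whence the error `2q/N`.
  have := (abs_le.1 (abs_le_of_hat_pos hj)).1
  rw [div_mul_eq_mul_div, div_le_iff₀ hN', add_mul (|t _|), mul_right_comm (2 / _), div_mul_cancel₀ _ hN'.ne']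
  linarith

theorem sum_snd_mul_hat_le {N : ℕ} (hN : 0 < N) (t : Fin 2 → ℝ) :
    ∑ j : Fin (N + 1), ((N - (j : ℕ) + 1) / N : ℝ) * (hat N j).1 t ≤
      |t 1| + 2 / N * (|t 0| + |t 1|) := by
  have hN' : (0 : ℝ) < N := Nat.cast_pos.2 hN
  refine sum_mul_hat_le (by positivity) fun j hj => ?_
  -- Here `N|s| ≤ (j + 1) q` is used, together with `N q - N|s| = N|t|`.
  have := (abs_le.1 (abs_le_of_hat_pos hj)).2
  rw [div_mul_eq_mul_div, div_le_iff₀ hN', add_mul (|t _|), mul_right_comm (2 / _), div_mul_cancel₀ _ hN'.ne']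
  linarith

/-- The coefficients are rounded up: on the support of `hat N j` both `|s| ≤ (j+1)/N * q` and `|t| ≤
(N-j+1)/N * q` hold. The geometric mean is monotone in each argument, and of two multiples of `q` it
is `q` times the mean of the factors. -/
theorem geom_le_sum_mul_hat {N : ℕ} (hN : 0 < N) (θ : Set.Ioo (0 : ℝ) 1) (t : Fin 2 → ℝ) :
    (geom θ).1 t ≤ ∑ j : Fin (N + 1), ((((j : ℕ) + 1) / N : ℝ) ^ (θ : ℝ) *
      ((N - (j : ℕ) + 1) / N : ℝ) ^ (1 - θ : ℝ)) * (hat N j).1 t := by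
  have hN' : (0 : ℝ) < N := Nat.cast_pos.2 hN
  have hθ : (0 : ℝ) < 1 - θ := sub_pos.2 θ.2.2
  -- Indices stop at `j = N`, which keeps the second coefficient nonnegative.
  have hb : ∀ j : Fin (N + 1), (0 : ℝ) ≤ (N - (j : ℕ) + 1) / N := fun j => by
    have : ((j : ℕ) : ℝ) ≤ N := Nat.cast_le.2 (Nat.lt_succ_iff.1 j.2)
    exact div_nonneg (by linarith) hN'.le
  refine le_sum_mul_hat (fun j => mul_nonneg (by positivity) (Real.rpow_nonneg (hb j) _))
    (fun h => ?_) fun j hj => ?_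
  · have : |t 0| = 0 := by linarith [abs_nonneg (t 0), abs_nonneg (t 1)]
    show |t 0| ^ (θ : ℝ) * |t 1| ^ (1 - θ : ℝ) = 0
    rw [this, Real.zero_rpow θ.2.1.ne', zero_mul]
  · have hj := abs_le.1 (abs_le_of_hat_pos hj)
    set q := |t 0| + |t 1| with hq
    have hq0 : 0 ≤ q := by positivity
    have h₀ : |t 0| ≤ ((j : ℕ) + 1) / N * q := by
      rw [div_mul_eq_mul_div, le_div_iff₀ hN']
      linarith
    have h₁ : |t 1| ≤ (N - (j : ℕ) + 1) / N * q := by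
      rw [div_mul_eq_mul_div, le_div_iff₀ hN']
      have : |t 1| = q - |t 0| := by rw [hq]; ring
      rw [this]
      linarith
    have hq1 : q ^ (θ : ℝ) * q ^ (1 - θ : ℝ) = q := by
      rw [← Real.rpow_add' hq0 (by simp), add_sub_cancel, Real.rpow_one]
    calc |t 0| ^ (θ : ℝ) * |t 1| ^ (1 - θ : ℝ)
        ≤ (((j : ℕ) + 1) / N * q) ^ (θ : ℝ) * ((N - (j : ℕ) + 1) / N * q) ^ (1 - θ : ℝ) :=
          mul_le_mul (Real.rpow_le_rpow (abs_nonneg _) h₀ θ.2.1.le)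
            (Real.rpow_le_rpow (abs_nonneg _) h₁ hθ.le) (by positivity)
            (Real.rpow_nonneg ((abs_nonneg _).trans h₀) _)
      _ = _ := by
          rw [Real.mul_rpow (by positivity) hq0, Real.mul_rpow (hb j) hq0, mul_mul_mul_comm, hq1]

end Hat

/-! ### Transfer to the Banach lattice -/

section BanachLattice

variable {E : Type*} [NormedAddCommGroup E] [Lattice E] [IsOrderedAddMonoid E] [HasSolidNorm E]
  [NormedSpace ℝ E] [IsOrderedModule ℝ E] [CompleteSpace E]

theorem krivine_nonneg {n : ℕ} (x : Fin n → E) {f : PosHom n} (hf : ∀ t, 0 ≤ f.1 t) :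
    0 ≤ krivine x f := by
  rw [← map_zero (krivine x)]
  exact (isKrivineCalculus_krivine x).mono hf

/-- The function `t ↦ |t i|`. -/
noncomputable def PosHom.absCoord {n : ℕ} (i : Fin n) : PosHom n :=
  PosHom.max (PosHom.coord i) (-PosHom.coord i)

theorem PosHom.absCoord_apply {n : ℕ} (i : Fin n) (t : Fin n → ℝ) :
    (PosHom.absCoord i).1 t = |t i| := rfl

theorem krivine_absCoord {n : ℕ} (x : Fin n → E) (i : Fin n) :
    krivine x (PosHom.absCoord i) = |x i| := by
  rw [PosHom.absCoord, (isKrivineCalculus_krivine x).map_max, map_neg,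
    (isKrivineCalculus_krivine x).map_coord, abs]

theorem krivine_sum_smul {n : ℕ} {ι : Type*} [Fintype ι] (x : Fin n → E) (c : ι → ℝ)
    (f : ι → PosHom n) : krivine x (∑ j, c j • f j) = ∑ j, c j • krivine x (f j) := by
  simp

theorem modulus_nonneg (z : Complexification E) : 0 ≤ modulus z :=
  krivine_nonneg _ fun _ => Real.sqrt_nonneg _

theorem geomMean_nonneg (θ : Set.Ioo (0 : ℝ) 1) (z w : Complexification E) :
    0 ≤ geomMean θ z w :=
  krivine_nonneg _ fun _ => mul_nonneg (Real.rpow_nonneg (abs_nonneg _) _)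
    (Real.rpow_nonneg (abs_nonneg _) _)

/-- In the description of the modulus as a supremum over angles, `cos φ • x ≤ x` since `x ≥ 0`, and
the angle `0` attains `x`. -/
theorem modulus_ofReal {x : E} (hx : 0 ≤ x) : modulus (ofReal E x) = x := by
  refine (isLUB_modulus (ofReal E x)).unique ⟨?_, fun u hu => ?_⟩
  · rintro _ ⟨φ, _, rfl⟩
    show Real.cos φ • x + Real.sin φ • (0 : E) ≤ x
    rw [smul_zero, add_zero]
    exact smul_le_of_le_one_left hx (Real.cos_le_one φ)
  · have := hu ⟨0, ⟨le_rfl, by positivity⟩, rfl⟩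
    simpa [ofReal] using this

theorem sum_apply_posHom {n : ℕ} {ι : Type*} [Fintype ι] (c : ι → ℝ) (f : ι → PosHom n)
    (t : Fin n → ℝ) : (∑ j, c j • f j).1 t = ∑ j, c j * (f j).1 t := by
  simp

/-- The hat functions, evaluated at `(x, y)`, are positive vectors whose cone contains
approximations of `x`, `y` and their geometric mean. The errors are controlled in order by multiples
of the single vector `x + y`, so monotonicity of `Q` absorbs them. -/
theorem HomPoly.eval_krivine_geom_le {m : ℕ} {Q : HomPoly ℝ m E} (hQ : 0 ≤ Q)
    (θ : Set.Ioo (0 : ℝ) 1) {x y : E} (hx : 0 ≤ x) (hy : 0 ≤ y) :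
    Q.eval (krivine ![x, y] (geom θ)) ≤ Q.eval x ^ (θ : ℝ) * Q.eval y ^ (1 - θ : ℝ) := by
  have hθ : (0 : ℝ) < 1 - θ := sub_pos.2 θ.2.2
  have hτ := isKrivineCalculus_krivine ![x, y]
  -- Since `x, y ≥ 0`, they are also the values of `|s|` and `|t|`. Inequalities in `|s|` and `|t|`,
  -- valid on the whole plane, can therefore be transferred.
  have h₀ : krivine ![x, y] (PosHom.absCoord 0) = x := by
    rw [krivine_absCoord]; exact abs_of_nonneg hx
  have h₁ : krivine ![x, y] (PosHom.absCoord 1) = y := by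
    rw [krivine_absCoord]; exact abs_of_nonneg hy
  have key : ∀ N : ℕ, Q.eval (krivine ![x, y] (geom θ)) ≤
      Q.eval (x + (2 / (N + 1 : ℕ) : ℝ) • (x + y)) ^ (θ : ℝ) *
        Q.eval (y + (2 / (N + 1 : ℕ) : ℝ) • (x + y)) ^ (1 - θ : ℝ) := by
    intro k
    -- The shift by one keeps the number `N` of subdivisions positive.
    obtain ⟨N, rfl, hN⟩ : ∃ N, N = k + 1 ∧ 0 < N := ⟨k + 1, rfl, k.succ_pos⟩
    generalize k + 1 = N at hN
    have hN' : (0 : ℝ) < N := Nat.cast_pos.2 hN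
    let e : Fin (N + 1) → E := fun j => krivine ![x, y] (hat N j)
    let a : Fin (N + 1) → ℝ := fun j => ((j : ℕ) + 1) / N
    let b : Fin (N + 1) → ℝ := fun j => (N - (j : ℕ) + 1) / N
    have he : ∀ j, 0 ≤ e j := fun j => krivine_nonneg _ (hat_nonneg N j)
    have ha : ∀ j, 0 ≤ a j := fun j => by positivity
    have hb : ∀ j, 0 ≤ b j := fun j => by
      have : ((j : ℕ) : ℝ) ≤ N := Nat.cast_le.2 (Nat.lt_succ_iff.1 j.2)
      exact div_nonneg (by linarith) hN'.le
    have hu : krivine ![x, y] (geom θ) ≤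
        ∑ j, (a j ^ (θ : ℝ) * b j ^ (1 - θ : ℝ)) • e j := by
      rw [← krivine_sum_smul]
      refine hτ.mono fun t => ?_
      rw [sum_apply_posHom]
      exact geom_le_sum_mul_hat hN θ t
    have hxa : ∑ j, a j • e j ≤ x + (2 / N : ℝ) • (x + y) := by
      have : x + (2 / N : ℝ) • (x + y) = krivine ![x, y] (PosHom.absCoord 0 +
          (2 / N : ℝ) • (PosHom.absCoord 0 + PosHom.absCoord 1)) := by
        simp only [map_add, map_smul, h₀, h₁]
      rw [← krivine_sum_smul, this]
      refine hτ.mono fun t => ?_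
      rw [sum_apply_posHom]
      exact sum_fst_mul_hat_le hN t
    have hyb : ∑ j, b j • e j ≤ y + (2 / N : ℝ) • (x + y) := by
      have : y + (2 / N : ℝ) • (x + y) = krivine ![x, y] (PosHom.absCoord 1 +
          (2 / N : ℝ) • (PosHom.absCoord 0 + PosHom.absCoord 1)) := by
        simp only [map_add, map_smul, h₀, h₁]
      rw [← krivine_sum_smul, this]
      refine hτ.mono fun t => ?_
      rw [sum_apply_posHom]
      exact sum_snd_mul_hat_le hN t
    have hsa : 0 ≤ ∑ j, a j • e j := Finset.sum_nonneg fun j _ => smul_nonneg (ha j) (he j)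
    have hsb : 0 ≤ ∑ j, b j • e j := Finset.sum_nonneg fun j _ => smul_nonneg (hb j) (he j)
    -- Monotonicity passes from the geometric mean up to the cone of the `e j`, Hölder's inequality
    -- applies there, and monotonicity passes up again to the perturbed `x` and `y`.
    calc Q.eval (krivine ![x, y] (geom θ))
        ≤ Q.eval (∑ j, (a j ^ (θ : ℝ) * b j ^ (1 - θ : ℝ)) • e j) :=
          HomPoly.eval_mono hQ (krivine_nonneg _ fun _ =>
            mul_nonneg (Real.rpow_nonneg (abs_nonneg _) _) (Real.rpow_nonneg (abs_nonneg _) _)) hu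
      _ ≤ Q.eval (∑ j, a j • e j) ^ (θ : ℝ) * Q.eval (∑ j, b j • e j) ^ (1 - θ : ℝ) :=
          HomPoly.eval_sum_rpow_le hQ θ.2.1 θ.2.2 ha hb he
      _ ≤ _ := mul_le_mul
          (Real.rpow_le_rpow (HomPoly.eval_nonneg hQ hsa) (HomPoly.eval_mono hQ hsa hxa) θ.2.1.le)
          (Real.rpow_le_rpow (HomPoly.eval_nonneg hQ hsb) (HomPoly.eval_mono hQ hsb hyb) hθ.le)
          (Real.rpow_nonneg (HomPoly.eval_nonneg hQ hsb) _)
          (Real.rpow_nonneg (HomPoly.eval_nonneg hQ (hsa.trans hxa)) _)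
  have hδ : Filter.Tendsto (fun N : ℕ => (2 / (N + 1 : ℕ) : ℝ)) Filter.atTop (nhds 0) :=
    (tendsto_const_div_atTop_nhds_zero_nat 2).comp (Filter.tendsto_add_atTop_nat 1)
  have hlim : ∀ (v : E) {s : ℝ}, 0 < s → Filter.Tendsto
      (fun N : ℕ => Q.eval (v + (2 / (N + 1 : ℕ) : ℝ) • (x + y)) ^ s) Filter.atTop
      (nhds (Q.eval v ^ s)) := by
    intro v s hs
    have h := ((Q.continuous_eval_add_smul v (x + y)).tendsto 0).comp hδ
    -- At `δ = 0` the line passes through `v`. The positive exponent makes the real power continuous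
    -- even if `Q.eval v = 0`.
    rw [zero_smul, add_zero] at h
    exact h.rpow_const (Or.inr hs.le)
  exact ge_of_tendsto' ((hlim x θ.2.1).mul (hlim y hθ)) key

end BanachLattice

end ComplexBanachLattice

/-! ### Solidity and logarithmic convexity of the convergence set -/

theorem theorem3p2 {E : Type*} [NormedAddCommGroup E] [Lattice E] [IsOrderedAddMonoid E]
    [HasSolidNorm E] [NormedSpace ℝ E] [IsOrderedModule ℝ E] [CompleteSpace E]
    (P : ∀ m : ℕ, HomPoly ℂ m (Complexification E)) (hP : ∀ m, IsRegular (P m)) :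
    IsSolid (regularConvergenceSet P hP) ∧
    IsLogConvex (regularConvergenceSet P hP) ∧
    (∀ (m : ℕ) (Q : HomPoly ℝ m E), 0 ≤ Q →
      ∀ (θ : Set.Ioo (0 : ℝ) 1) (z w : Complexification E),
        Q.eval (geomMean θ z w) ≤
          Q.eval (modulus z) ^ (θ : ℝ) * Q.eval (modulus w) ^ (1 - θ : ℝ)) := by
  have hgeom : ∀ (m : ℕ) (Q : HomPoly ℝ m E), 0 ≤ Q →
      ∀ (θ : Set.Ioo (0 : ℝ) 1) (z w : Complexification E),
        Q.eval (geomMean θ z w) ≤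
          Q.eval (modulus z) ^ (θ : ℝ) * Q.eval (modulus w) ^ (1 - θ : ℝ) :=
    fun m Q hQ θ z w => HomPoly.eval_krivine_geom_le hQ θ (modulus_nonneg z) (modulus_nonneg w)
  have hpos := fun m => polyAbs_nonneg (P m) (hP m)
  refine ⟨fun z hz w hwz => ?_, fun z hz w hw θ => ?_, hgeom⟩
  · exact Summable.of_nonneg_of_le
      (fun m => HomPoly.eval_nonneg (hpos m) (modulus_nonneg w))
      (fun m => HomPoly.eval_mono (hpos m) (modulus_nonneg w) hwz) hz
  -- Weighted AM-GM turns the product bound into a linear combination of terms of two convergent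
  -- series. The geometric mean is positive, hence equal to its own modulus.
  · have hle : ∀ m, (polyAbs (P m) (hP m)).eval (modulus (ofReal E (geomMean θ z w))) ≤
        θ * (polyAbs (P m) (hP m)).eval (modulus z) +
          (1 - θ) * (polyAbs (P m) (hP m)).eval (modulus w) := fun m => by
      rw [modulus_ofReal (geomMean_nonneg θ z w)]
      exact (hgeom m _ (hpos m) θ z w).trans (Real.geom_mean_le_arith_mean2_weighted θ.2.1.le
        (sub_nonneg.2 θ.2.2.le) (HomPoly.eval_nonneg (hpos m) (modulus_nonneg z))
        (HomPoly.eval_nonneg (hpos m) (modulus_nonneg w)) (add_sub_cancel _ _))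
    exact Summable.of_nonneg_of_le
      (fun m => HomPoly.eval_nonneg (hpos m) (modulus_nonneg _)) hle
      ((Summable.mul_left _ hz).add (Summable.mul_left _ hw))
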